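/- Let $b\ge 2$ be an integer, let $\alpha_1,\alpha_2>1$ be real, and let $(\gamma^{(1)}_j)_{j\ge1}$, $(\gamma^{(2)}_j)_{j\ge1}$ be non-increasing sequences of positive reals. For $k\in\mathbb N_0$ with base-$b$ digits $k=\kappa_0+\kappa_1b+\dots+\kappa_ab^a$ and $x\in[0,1)$ with $x=\sum_{i\ge1}\xi_ib^{-i}$ (infinitely many $\xi_i\ne b-1$), let $\mathrm{wal}_k(x)=\exp(2\pi \mathrm i(\xi_1\kappa_0+\dots+\xi_{a+1}\kappa_a)/b)$. Put $r^{(1)}_\gamma(0)=1$, $r^{(1)}_\gamma(k)=\gamma b^{-\alpha_1\lfloor\log_bk\rfloor}$ for $k\ge 1$, and $r^{(2)}_\gamma(0)=1$, $r^{(2)}_\gamma(l)=\gamma|l|^{-\alpha_2}$ for $l\in\mathbb Z\setminus\{0\}$. For $s_1,s_2\in\mathbb N_0$ with $s_1+s_2\ge1$, $\mathbf k\in\mathbb N_0^{s_1}$, $\mathbf l\in\mathbb Z^{s_2}$ put $r(\mathbf k,\mathbf l)=\prod_{j=1}^{s_1}r^{(1)}_{\gamma^{(1)}_j}(k_j)\prod_{j=1}^{s_2}r^{(2)}_{\gamma^{(2)}_j}(l_j)$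 and $w_{\mathbf k,\mathbf l}(\mathbf x,\mathbf y)=\prod_{j=1}^{s_1}\mathrm{wal}_{k_j}(x_j)\cdot\exp(2\pi \mathrm i\,\mathbf l\cdot\mathbf y)$. The hybrid space $\mathcal H_{s_1,s_2}$ (the tensor product of the $s_1$-dimensional weighted Walsh space and the $s_2$-dimensional weighted Korobov space) consists of the integrable functions $f=\sum_{\mathbf k,\mathbf l}\widehat f(\mathbf k,\mathbf l)\,w_{\mathbf k,\mathbf l}$ (pointwise on $[0,1)^{s_1+s_2}$), $\widehat f(\mathbf k,\mathbf l)=\int f\,\overline{w_{\mathbf k,\mathbf l}}$, with $\|f\|^2=\sum_{\mathbf k,\mathbf l}r(\mathbf k,\mathbf l)^{-1}|\widehat f(\mathbf k,\mathbf l)|^2<\infty$. For $N\ge1$ let $e(N,s_1,s_2)$ be the infimum, over all families of $N$ points $p_0,\dots,p_{N-1}\in[0,1)^{s_1+s_2}$, of $\sup_{\|f\|\le1}\bigl|\int f-\frac1N\sum_{n=0}^{N-1}f(p_n)\bigr|$; let $e(0,s_1,s_2)=\sup_{\|f\|\le1}\bigl|\int f\bigr|$; and for $\varepsilon\in(0,1]$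 let $N_{\min}(\varepsilon,s_1,s_2)$ be the least $N\ge1$ with $e(N,s_1,s_2)\le\varepsilon\,e(0,s_1,s_2)$. QMC integration is called strongly polynomially tractable if $N_{\min}(\varepsilon,s_1,s_2)\le c\,\varepsilon^{-p}$ for some $c,p\ge0$ and all $\varepsilon,s_1,s_2$; polynomially tractable if $N_{\min}(\varepsilon,s_1,s_2)\le c\,(s_1+s_2)^q\varepsilon^{-p}$ for some $c,p,q\ge0$ and all $\varepsilon,s_1,s_2$; weakly tractable if $\log N_{\min}(\varepsilon,s_1,s_2)/(s_1+s_2+\varepsilon^{-1})\to0$ as $s_1+s_2+\varepsilon^{-1}\to\infty$. **Theorem.** QMC integration in the spaces $\mathcal H_{s_1,s_2}$ is 1. strongly polynomially tractable if and only if $\sum_{j=1}^{s_1}\gamma^{(1)}_j+\sum_{j=1}^{s_2}\gamma^{(2)}_j$ stays bounded as $s_1+s_2\to\infty$; 2. polynomially tractable if and only if $\frac{1}{\log s_1}\sum_{j=1}^{s_1}\gamma^{(1)}_j+\frac{1}{\log s_2}\sum_{j=1}^{s_2}\gamma^{(2)}_j$ stays bounded, over $s_1,s_2\ge2$, as $s_1+s_2\to\infty$;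 3. weakly tractable if and only if $\frac1{s_1}\sum_{j=1}^{s_1}\gamma^{(1)}_j+\frac1{s_2}\sum_{j=1}^{s_2}\gamma^{(2)}_j\to0$ as $s_1\to\infty$ and $s_2\to\infty$. -/

import Mathlib

open Filter Topology MeasureTheory
open scoped ENNReal

noncomputable section

namespace HybridQMC

/-- The half-open unit interval `[0,1)`. -/
abbrev I01 : Type := Set.Ico (0 : ℝ) 1

instance instMeasureSpaceI01 : MeasureSpace I01 := Measure.Subtype.measureSpace

/-- Lebesgue measure on `[0,1)` has total mass one. -/
instance instIsProbabilityMeasureI01 : IsProbabilityMeasure (volume : Measure I01) :=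
  ⟨by rw [Measure.Subtype.volume_univ measurableSet_Ico.nullMeasurableSet]; simp⟩

/-- The half-open cube `[0,1)^(s₁+s₂)`, whose points are pairs `(x, y)`. It carries Lebesgue measure
(the product of the measures on the factors), written `volume`. -/
abbrev Cube (s₁ s₂ : ℕ) : Type := (Fin s₁ → I01) × (Fin s₂ → I01)

/-- Pairs `(k, l)` of frequencies, `k ∈ ℕ₀^s₁`, `l ∈ ℤ^s₂`. -/
abbrev Freq (s₁ s₂ : ℕ) : Type := (Fin s₁ → ℕ) × (Fin s₂ → ℤ)

/-- `e(v) = exp(2πiv)`. -/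
def ee (v : ℝ) : ℂ := Complex.exp (2 * Real.pi * Complex.I * v)

/-- The digit `κ_i` in `k = ∑_{i ≥ 0} κ_i b^i`. -/
def natDigit (b k i : ℕ) : ℕ := k / b ^ i % b

/-- The digit `ξ_i` (`i ≥ 1`) in `x = ∑_{i ≥ 1} ξ_i b^(-i)`, `0 ≤ x < 1`, for the expansion
in which infinitely many digits differ from `b - 1`. -/
def realDigit (b : ℕ) (x : ℝ) (i : ℕ) : ℕ := ⌊x * (b : ℝ) ^ i⌋₊ % b

/-- The `k`-th Walsh function in base `b`:
`e((ξ_1 κ_0 + ⋯ + ξ_{a+1} κ_a) / b)` with `κ_a` the leading digit of `k`, i.e. `a = ⌊log_b k⌋`. -/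
def wal (b k : ℕ) (x : ℝ) : ℂ :=
  ee ((∑ i ∈ Finset.range (Nat.log b k + 1), (realDigit b x (i + 1) * natDigit b k i : ℝ)) / b)

/-- The multivariate Walsh function `∏_j wal_{k_j}(x_j)`. -/
def walVec (b : ℕ) {s : ℕ} (k : Fin s → ℕ) (x : Fin s → I01) : ℂ :=
  ∏ j, wal b (k j) (x j)

/-- The multivariate trigonometric function `e(l · y)`. -/
def trigVec {s : ℕ} (l : Fin s → ℤ) (y : Fin s → I01) : ℂ :=
  ee (∑ j, (l j : ℝ) * (y j : ℝ))

/-- The basis function `(x, y) ↦ wal_k(x) e_l(y)`. -/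
def basisFun (b : ℕ) {s₁ s₂ : ℕ} (h : Freq s₁ s₂) (p : Cube s₁ s₂) : ℂ :=
  walVec b h.1 p.1 * trigVec h.2 p.2

/-- One-dimensional Walsh decay: `1` at `k = 0`, otherwise `γ b^(-α ⌊log_b k⌋)`. -/
def rWalsh (b : ℕ) (α γ : ℝ) (k : ℕ) : ℝ :=
  if k = 0 then 1 else γ * (b : ℝ) ^ (-(α * (Nat.log b k : ℝ)))

/-- One-dimensional Korobov decay: `1` at `l = 0`, otherwise `γ |l|^(-α)`. -/
def rKorobov (α γ : ℝ) (l : ℤ) : ℝ :=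
  if l = 0 then 1 else γ * |(l : ℝ)| ^ (-α)

/-- The parameters of the family of hybrid spaces: base `b`, smoothness `α₁, α₂`, and weight sequences.
The sequences are indexed from zero: `γ₁ j` and `γ₂ j` are the weights of the coordinates
number `j + 1`. -/
structure Params where
  /-- base of the Walsh functions -/
  b : ℕ
  /-- smoothness of the Walsh part -/
  α₁ : ℝ
  /-- smoothness of the Korobov part -/
  α₂ : ℝ
  /-- weights of the Walsh part -/
  γ₁ : ℕ → ℝ
  /-- weights of the Korobov part -/
  γ₂ : ℕ → ℝ

variable (P : Params)

/-- `r^(1)(k) r^(2)(l)`, the product of the one-dimensional decays. -/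
def decay {s₁ s₂ : ℕ} (h : Freq s₁ s₂) : ℝ :=
  (∏ j : Fin s₁, rWalsh P.b P.α₁ (P.γ₁ j) (h.1 j)) *
    ∏ j : Fin s₂, rKorobov P.α₂ (P.γ₂ j) (h.2 j)

/-- The coefficient `f̂(k,l) = ∫ f(x,y) conj(wal_k(x) e_l(y)) d(x,y)`. -/
def coeff (b : ℕ) {s₁ s₂ : ℕ} (f : Cube s₁ s₂ → ℂ) (h : Freq s₁ s₂) : ℂ :=
  ∫ p, f p * (starRingEnd ℂ) (basisFun b h p)

/-- Membership in the hybrid space: `f` is the pointwise sum of its Walsh-trigonometric series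
and has finite norm. -/
structure MemHybrid {s₁ s₂ : ℕ} (f : Cube s₁ s₂ → ℂ) : Prop where
  integrable : Integrable f
  summable_norm : Summable fun h : Freq s₁ s₂ => (decay P h)⁻¹ * ‖coeff P.b f h‖ ^ 2
  hasSum : ∀ p, HasSum (fun h : Freq s₁ s₂ => coeff P.b f h * basisFun P.b h p) (f p)

/-- The norm of the hybrid space, `(∑_{k,l} r(k,l)⁻¹ |f̂(k,l)|²)^(1/2)`. -/
def hybridNorm {s₁ s₂ : ℕ} (f : Cube s₁ s₂ → ℂ) : ℝ :=
  Real.sqrt (∑' h : Freq s₁ s₂, (decay P h)⁻¹ * ‖coeff P.b f h‖ ^ 2)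

/-- The unit ball of the hybrid space. -/
def unitBall (s₁ s₂ : ℕ) : Set (Cube s₁ s₂ → ℂ) :=
  {f | MemHybrid P f ∧ hybridNorm P f ≤ 1}

/-- The QMC rule `(1/N) ∑_{n < N} f(x_n, y_n)`. -/
def qmc {s₁ s₂ N : ℕ} (S : Fin N → Cube s₁ s₂) (f : Cube s₁ s₂ → ℂ) : ℂ :=
  (1 / (N : ℂ)) * ∑ n, f (S n)

/-- The worst-case error of the QMC rule based on the points `S`. -/
def wce {s₁ s₂ N : ℕ} (S : Fin N → Cube s₁ s₂) : ℝ≥0∞ :=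
  ⨆ f ∈ unitBall P s₁ s₂, ‖(∫ p, f p) - qmc S f‖ₑ

/-- The `N`-th minimal QMC worst-case error (for `N ≥ 1`). -/
def minError (s₁ s₂ N : ℕ) : ℝ≥0∞ :=
  ⨅ S : Fin N → Cube s₁ s₂, wce P S

/-- The initial error. -/
def initError (s₁ s₂ : ℕ) : ℝ≥0∞ :=
  ⨆ f ∈ unitBall P s₁ s₂, ‖∫ p, f p‖ₑ

/-- The information complexity: the least `N ≥ 1` with `e(N, s) ≤ ε e(0, s)`. -/
def infoComplexity (ε : ℝ) (s₁ s₂ : ℕ) : ℕ :=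
  sInf {N : ℕ | 1 ≤ N ∧ minError P s₁ s₂ N ≤ ENNReal.ofReal ε * initError P s₁ s₂}

/-- Strong polynomial QMC-tractability. -/
def StronglyPolynomiallyTractable : Prop :=
  ∃ c p : ℝ, 0 ≤ c ∧ 0 ≤ p ∧
    ∀ s₁ s₂ : ℕ, 1 ≤ s₁ + s₂ → ∀ ε : ℝ, 0 < ε → ε ≤ 1 →
      (infoComplexity P ε s₁ s₂ : ℝ) ≤ c * ε ^ (-p)

/-- Polynomial QMC-tractability. -/
def PolynomiallyTractable : Prop :=
  ∃ c p q : ℝ, 0 ≤ c ∧ 0 ≤ p ∧ 0 ≤ q ∧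
    ∀ s₁ s₂ : ℕ, 1 ≤ s₁ + s₂ → ∀ ε : ℝ, 0 < ε → ε ≤ 1 →
      (infoComplexity P ε s₁ s₂ : ℝ) ≤ c * ((s₁ + s₂ : ℕ) : ℝ) ^ q * ε ^ (-p)

/-- Weak QMC-tractability: `log N_min(ε, s) / (s + ε⁻¹) → 0` as `s + ε⁻¹ → ∞`, `s = s₁ + s₂`,
where `(s₁, s₂, ε)` ranges over the admissible triples `s₁ + s₂ ≥ 1`, `0 < ε ≤ 1`. -/
def WeaklyTractable : Prop :=
  Tendsto
    (fun t : ℕ × ℕ × ℝ =>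
      Real.log (infoComplexity P t.2.2 t.1 t.2.1) / ((t.1 : ℝ) + t.2.1 + t.2.2⁻¹))
    (comap (fun t : ℕ × ℕ × ℝ => (t.1 : ℝ) + t.2.1 + t.2.2⁻¹) atTop ⊓
      𝓟 {t | 1 ≤ t.1 + t.2.1 ∧ 0 < t.2.2 ∧ t.2.2 ≤ 1})
    (𝓝 0)

/-- The filter `s₁ + s₂ → ∞` on pairs of dimensions. -/
def totalDimAtTop : Filter (ℕ × ℕ) := comap (fun s : ℕ × ℕ => s.1 + s.2) atTop

end HybridQMC

end

namespace HybridQMC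

/-! ### Characters, Walsh functions and orthonormality of the basis -/

section

/-! Write Γ for the sum of all the weights in dimension (s₁, s₂). The theorem follows from two
bounds whose constants do not depend on the dimensions or on ε: N_min(ε) ≤ 2 ε⁻² exp(μΓ) and
N_min(1) ≥ exp(c'Γ)/2 with c' > 0.

Upper bound (`exists_infoComplexity_le`). By Cauchy–Schwarz, the squared error of a QMC rule Q is at
most the sum of r(h)|Q(w_h)|² over h ≠ 0. Since the nonconstant basis functions have mean zero,
choosing the points one after another, each no worse than the average (`exists_points`), makes this
at most N⁻¹ ∑ r(h). The sum of r factorizes over the coordinates, and because α₁, α₂ > 1 each factor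
is at most the exponential of a constant times γ.

Lower bound (`exp_half_le_of_minError_le_one`). Keep only the frequencies k_j < b and l_j ∈ {-1, 0,
1}, and shrink every weight by a fixed c so that the truncated kernel is pointwise nonnegative. Its
average over all pairs of points is then at least the diagonal part, which is at least exp(cΓ/2)/N;
deleting frequency zero subtracts 1. So even reaching the initial error, which is 1, forces N ≥
exp(cΓ/2)/2.

Each notion of tractability thereby becomes a growth condition on Γ. Necessity needs only ε = 1; in
the polynomial and weak cases setting s₁ or s₂ to zero separates the two weight sums. -/

lemma ee_zero : ee 0 = 1 := by simp [ee]

lemma ee_add (u v : ℝ) : ee (u + v) = ee u * ee v := by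
  simp only [ee, ← Complex.exp_add]
  congr 1
  push_cast
  ring

lemma ee_sum {ι : Type*} (s : Finset ι) (f : ι → ℝ) : ee (∑ i ∈ s, f i) = ∏ i ∈ s, ee (f i) := by
  simp only [ee, ← Complex.exp_sum]
  congr 1
  push_cast
  rw [Finset.mul_sum]

lemma ee_natCast_mul (n : ℕ) (v : ℝ) : ee (n * v) = ee v ^ n := by
  simp only [ee, ← Complex.exp_nat_mul]
  congr 1
  push_cast
  ring

lemma norm_ee (v : ℝ) : ‖ee v‖ = 1 := by
  have h : (2 * Real.pi * Complex.I * v : ℂ) = ((2 * Real.pi * v : ℝ) : ℂ) * Complex.I := by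
    push_cast
    ring
  rw [ee, h, Complex.norm_exp_ofReal_mul_I]

lemma conj_ee (v : ℝ) : (starRingEnd ℂ) (ee v) = ee (-v) := by
  rw [ee, ee, ← Complex.exp_conj]
  congr 1
  simp [map_ofNat]

lemma ee_eq_one_iff (v : ℝ) : ee v = 1 ↔ ∃ n : ℤ, v = n := by
  rw [ee, Complex.exp_eq_one_iff]
  have h : (2 * Real.pi * Complex.I : ℂ) ≠ 0 := Complex.two_pi_I_ne_zero
  constructor
  · rintro ⟨n, hn⟩
    refine ⟨n, ?_⟩
    rw [mul_comm (n : ℂ)] at hn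
    exact_mod_cast mul_left_cancel₀ h hn
  · rintro ⟨n, rfl⟩
    exact ⟨n, by push_cast; ring⟩

lemma ee_intCast (n : ℤ) : ee n = 1 := (ee_eq_one_iff _).2 ⟨n, rfl⟩

lemma continuous_ee : Continuous ee := by
  unfold ee
  fun_prop

/-- Orthogonality of the additive characters of `ℤ/b`. -/
lemma sum_range_ee {b : ℕ} (hb : 0 < b) (d : ℤ) :
    ∑ x ∈ Finset.range b, ee (x * (d / b)) = if (b : ℤ) ∣ d then (b : ℂ) else 0 := by
  have hb' : (b : ℝ) ≠ 0 := by positivity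
  simp only [ee_natCast_mul]
  split_ifs with h
  · obtain ⟨m, rfl⟩ := h
    have h1 : ee (((b * m : ℤ) : ℝ) / b) = 1 := by
      rw [ee_eq_one_iff]
      exact ⟨m, by push_cast; field_simp⟩
    simp only [h1, one_pow]
    simp
  · have h1 : ee ((d : ℝ) / b) ≠ 1 := by
      rw [Ne, ee_eq_one_iff]
      rintro ⟨n, hn⟩
      apply h
      refine ⟨n, ?_⟩
      rw [div_eq_iff hb'] at hn
      have : (d : ℝ) = ((b * n : ℤ) : ℝ) := by rw [hn]; push_cast; ring
      exact_mod_cast this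
    have h2 : ee ((d : ℝ) / b) ^ b = 1 := by
      rw [← ee_natCast_mul, mul_div_cancel₀ _ hb', ee_intCast]
    rw [geom_sum_eq h1, h2]
    simp

lemma integral_I01 (f : ℝ → ℂ) : ∫ x : I01, f x = ∫ x in (0 : ℝ)..1, f x := by
  rw [intervalIntegral.integral_of_le zero_le_one, ← integral_Ico_eq_integral_Ioc]
  exact integral_subtype measurableSet_Ico f

lemma integral_ee_int (l : ℤ) : ∫ x : I01, ee (l * (x : ℝ)) = if l = 0 then 1 else 0 := by
  rw [integral_I01 fun x => ee (l * x)]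
  split_ifs with h
  · simp [h, ee_zero]
  · have hc : (2 * Real.pi * Complex.I * l : ℂ) ≠ 0 :=
      mul_ne_zero Complex.two_pi_I_ne_zero (by exact_mod_cast h)
    have h1 : ∀ x : ℝ, ee (l * x) = Complex.exp (2 * Real.pi * Complex.I * l * x) := by
      intro x
      rw [ee]
      congr 1
      push_cast
      ring
    simp only [h1]
    rw [integral_exp_mul_complex hc, ← h1, ← h1]
    simp [ee_intCast, ee_zero]

/-- The integral of a step function with `M` steps of equal length. -/
lemma integral_floor_mul (G : ℕ → ℂ) {M : ℕ} (hM : 0 < M) :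
    ∫ x : I01, G ⌊(x : ℝ) * M⌋₊ = (M : ℂ)⁻¹ * ∑ m ∈ Finset.range M, G m := by
  have hM' : (0 : ℝ) < M := by exact_mod_cast hM
  rw [integral_I01 fun x => G ⌊x * M⌋₊]
  have hle : ∀ k : ℕ, (k : ℝ) / M ≤ ((k + 1 : ℕ) : ℝ) / M := fun k => by
    gcongr
    simp
  have hG : ∀ k : ℕ, Set.EqOn (fun _ : ℝ => G k) (fun x : ℝ => G ⌊x * M⌋₊)
      (Set.Ico ((k : ℝ) / M) (((k + 1 : ℕ) : ℝ) / M)) := by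
    intro k x hx
    have h1 : (k : ℝ) ≤ x * M := (div_le_iff₀ hM').1 hx.1
    have h2 : x * M < k + 1 := by
      have := (lt_div_iff₀ hM').1 hx.2
      exact_mod_cast this
    have : ⌊x * M⌋₊ = k := (Nat.floor_eq_iff (le_trans (by positivity) h1)).2 ⟨h1, h2⟩
    simp only [this]
  have h := intervalIntegral.sum_integral_adjacent_intervals (f := fun x : ℝ => G ⌊x * M⌋₊)
    (μ := volume) (a := fun k : ℕ => (k : ℝ) / M) (n := M) (by
      intro k _
      rw [intervalIntegrable_iff_integrableOn_Ico_of_le (hle k)]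
      exact IntegrableOn.congr_fun (by simp) (hG k) measurableSet_Ico)
  simp only [Nat.cast_zero, zero_div, div_self hM'.ne'] at h
  rw [← h, Finset.mul_sum]
  refine Finset.sum_congr rfl fun k _ => ?_
  rw [intervalIntegral.integral_of_le (hle k), ← integral_Ico_eq_integral_Ioc,
    ← setIntegral_congr_fun measurableSet_Ico (hG k), setIntegral_const, measureReal_def,
    Real.volume_Ico]
  rw [ENNReal.toReal_ofReal (by linarith [hle k])]
  rw [Complex.real_smul]
  have hMc : (M : ℂ) ≠ 0 := by exact_mod_cast hM.ne'
  congr 1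
  push_cast
  field_simp
  ring

lemma sum_range_mul_eq (f : ℕ → ℂ) (M b : ℕ) :
    ∑ x ∈ Finset.range (M * b), f x =
      ∑ m ∈ Finset.range M, ∑ d ∈ Finset.range b, f (m * b + d) := by
  induction M with
  | zero => simp
  | succ M ih => rw [Finset.sum_range_succ, ← ih, Nat.succ_mul, Finset.sum_range_add]

/-- A sum over `m < b^n` of a product over the digits of `m` factorizes. -/
lemma sum_range_pow_prod_digit (b n : ℕ) (F : ℕ → ℕ → ℂ) :
    ∑ m ∈ Finset.range (b ^ n), ∏ i ∈ Finset.range n, F i (m / b ^ (n - 1 - i) % b) =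
      ∏ i ∈ Finset.range n, ∑ d ∈ Finset.range b, F i d := by
  induction n with
  | zero => simp
  | succ n ih =>
    rw [pow_succ, sum_range_mul_eq, Finset.prod_range_succ, ← ih, Finset.sum_mul]
    refine Finset.sum_congr rfl fun m _ => ?_
    rw [Finset.mul_sum]
    refine Finset.sum_congr rfl fun d hd => ?_
    have hd' : d < b := Finset.mem_range.1 hd
    have hb : 0 < b := by omega
    rw [Finset.prod_range_succ]
    congr 1
    · refine Finset.prod_congr rfl fun i hi => ?_
      have hi' : i < n := Finset.mem_range.1 hi
      have h1 : n + 1 - 1 - i = (n - 1 - i) + 1 := by omega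
      rw [h1, pow_succ', ← Nat.div_div_eq_div_mul]
      congr 3
      rw [mul_comm, Nat.mul_add_div hb, Nat.div_eq_of_lt hd', add_zero]
    · simp [Nat.mod_eq_of_lt hd']

lemma mod_pow_eq_of_digit_eq {b k k' : ℕ} (n : ℕ)
    (h : ∀ i < n, natDigit b k i = natDigit b k' i) : k % b ^ n = k' % b ^ n := by
  induction n with
  | zero => simp [Nat.mod_one]
  | succ n ih =>
    rw [Nat.mod_pow_succ, Nat.mod_pow_succ, ih fun i hi => h i (by omega)]
    have := h n (by omega)
    simp only [natDigit] at this
    rw [this]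

/-- The single integer ⌊x bⁿ⌋ carries the first n digits of x, so functions of those digits are step
functions with bⁿ equal steps. -/
lemma realDigit_eq_div {b : ℕ} (hb : 0 < b) (x : ℝ) {i n : ℕ} (hi : i < n) :
    realDigit b x (i + 1) = ⌊x * ((b ^ n : ℕ) : ℝ)⌋₊ / b ^ (n - 1 - i) % b := by
  have hb' : (b : ℝ) ≠ 0 := by positivity
  rw [realDigit, ← Nat.floor_div_natCast]
  congr 2
  have h : n = (i + 1) + (n - 1 - i) := by omega
  push_cast
  rw [eq_div_iff (by positivity)]
  conv_rhs => rw [h, pow_add]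
  ring

/-- Digits of k beyond the leading one are zero and contribute trivial factors; padding lets two
Walsh functions share one length n. -/
lemma wal_eq_prod {b : ℕ} (hb : 2 ≤ b) {k n : ℕ} (hn : Nat.log b k < n) (x : ℝ) :
    wal b k x = ∏ i ∈ Finset.range n, ee (realDigit b x (i + 1) * (natDigit b k i / b)) := by
  rw [wal, Finset.sum_div, ee_sum]
  have hsub : Finset.range (Nat.log b k + 1) ⊆ Finset.range n := by
    intro i
    simp only [Finset.mem_range]
    omega
  rw [← Finset.prod_subset hsub]
  · exact Finset.prod_congr rfl fun i _ => by rw [mul_div_assoc]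
  · intro i _ hi
    have hi' : Nat.log b k < i := by
      simp only [Finset.mem_range] at hi
      omega
    have : natDigit b k i = 0 := by
      rw [natDigit, Nat.div_eq_of_lt (Nat.lt_pow_of_log_lt (by omega) hi'), Nat.zero_mod]
    simp [this, ee_zero]

lemma wal_mul_conj_eq_prod {b : ℕ} (hb : 2 ≤ b) {k k' n : ℕ} (hn : Nat.log b k < n)
    (hn' : Nat.log b k' < n) (x : ℝ) :
    wal b k x * (starRingEnd ℂ) (wal b k' x) =
      ∏ i ∈ Finset.range n,
        ee (realDigit b x (i + 1) * (((natDigit b k i - natDigit b k' i : ℤ) : ℝ) / b)) := by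
  rw [wal_eq_prod hb hn, wal_eq_prod hb hn', map_prod, ← Finset.prod_mul_distrib]
  refine Finset.prod_congr rfl fun i _ => ?_
  rw [conj_ee, ← ee_add]
  congr 1
  push_cast
  ring

lemma norm_wal (b k : ℕ) (x : ℝ) : ‖wal b k x‖ = 1 := norm_ee _

/-- The Walsh functions are orthonormal. -/
lemma integral_wal_mul_conj {b : ℕ} (hb : 2 ≤ b) (k k' : ℕ) :
    ∫ x : I01, wal b k x * (starRingEnd ℂ) (wal b k' x) = if k = k' then 1 else 0 := by
  split_ifs with h
  · subst h
    simp [Complex.mul_conj', norm_wal]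
  · have hb0 : 0 < b := by omega
    set n := max (Nat.log b k) (Nat.log b k') + 1 with hn
    have hk : Nat.log b k < n := by omega
    have hk' : Nat.log b k' < n := by omega
    set d : ℕ → ℤ := fun i => natDigit b k i - natDigit b k' i with hd
    have h1 : ∀ x : ℝ, wal b k x * (starRingEnd ℂ) (wal b k' x) =
        (fun m : ℕ => ∏ i ∈ Finset.range n,
          (fun (i e : ℕ) => ee (e * ((d i : ℝ) / b))) i (m / b ^ (n - 1 - i) % b))
          ⌊x * ((b ^ n : ℕ) : ℝ)⌋₊ := by
      intro x
      rw [wal_mul_conj_eq_prod hb hk hk']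
      refine Finset.prod_congr rfl fun i hi => ?_
      rw [realDigit_eq_div hb0 x (Finset.mem_range.1 hi)]
    simp only [h1]
    have h2 := integral_floor_mul (fun m : ℕ => ∏ i ∈ Finset.range n,
          (fun (i e : ℕ) => ee (e * ((d i : ℝ) / b))) i (m / b ^ (n - 1 - i) % b))
          (M := b ^ n) (by positivity)
    rw [sum_range_pow_prod_digit b n fun (i e : ℕ) => ee (e * ((d i : ℝ) / b))] at h2
    refine h2.trans ?_
    -- Distinct indices differ in some digit below n; the character sum over that digit vanishes,
    -- and with it the product.
    obtain ⟨i, hi, hne⟩ : ∃ i < n, natDigit b k i ≠ natDigit b k' i := by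
      by_contra! hcon
      have h3 := mod_pow_eq_of_digit_eq n hcon
      rw [Nat.mod_eq_of_lt (Nat.lt_pow_of_log_lt (by omega) hk),
        Nat.mod_eq_of_lt (Nat.lt_pow_of_log_lt (by omega) hk')] at h3
      exact h h3
    rw [Finset.prod_eq_zero (Finset.mem_range.2 hi), mul_zero]
    rw [sum_range_ee hb0, if_neg]
    intro hdvd
    have l1 : natDigit b k i < b := Nat.mod_lt _ hb0
    have l2 : natDigit b k' i < b := Nat.mod_lt _ hb0
    have h4 : d i = 0 := Int.eq_zero_of_abs_lt_dvd hdvd (by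
      simp only [hd]
      rw [abs_lt]
      constructor <;> omega)
    simp only [hd] at h4
    omega

lemma measurable_wal (b k : ℕ) : Measurable fun x : I01 => wal b k x := by
  unfold wal
  refine continuous_ee.measurable.comp (Measurable.div_const ?_ _)
  refine Finset.measurable_sum _ fun i _ => Measurable.mul_const ?_ _
  unfold realDigit
  have h : Measurable fun x : I01 => ⌊(x : ℝ) * (b : ℝ) ^ (i + 1)⌋₊ :=
    Nat.measurable_floor.comp (measurable_subtype_coe.mul_const _)
  exact (measurable_from_nat (f := fun n : ℕ => ((n % b : ℕ) : ℝ))).comp h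

variable (b : ℕ) {s₁ s₂ : ℕ}

lemma trigVec_eq_prod (l : Fin s₂ → ℤ) (y : Fin s₂ → I01) :
    trigVec l y = ∏ j, ee (l j * (y j : ℝ)) := ee_sum _ _

lemma norm_basisFun (h : Freq s₁ s₂) (p : Cube s₁ s₂) : ‖basisFun b h p‖ = 1 := by
  simp [basisFun, walVec, trigVec, norm_wal, norm_ee]

lemma basisFun_zero (p : Cube s₁ s₂) : basisFun b 0 p = 1 := by
  simp [basisFun, walVec, trigVec, wal, natDigit, ee_zero]

lemma measurable_basisFun (h : Freq s₁ s₂) : Measurable (basisFun b h) := by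
  unfold basisFun walVec
  simp only [trigVec_eq_prod]
  refine Measurable.mul ?_ ?_
  · exact Finset.measurable_prod _ fun j _ =>
      (measurable_wal b (h.1 j)).comp ((measurable_pi_apply j).comp measurable_fst)
  · refine Finset.measurable_prod _ fun j _ => continuous_ee.measurable.comp ?_
    exact (measurable_subtype_coe.comp
      ((measurable_pi_apply j).comp measurable_snd)).const_mul _

lemma integrable_basisFun (h : Freq s₁ s₂) : Integrable (basisFun b h) :=
  Integrable.of_bound (measurable_basisFun b h).aestronglyMeasurable 1
    (Eventually.of_forall fun p => (norm_basisFun b h p).le)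

/-- Multivariate basis functions are orthonormal. -/
lemma integral_basisFun_mul_conj {b : ℕ} (hb : 2 ≤ b) (h h' : Freq s₁ s₂) :
    ∫ p, basisFun b h p * (starRingEnd ℂ) (basisFun b h' p) = if h = h' then 1 else 0 := by
  have h1 : ∀ p : Cube s₁ s₂, basisFun b h p * (starRingEnd ℂ) (basisFun b h' p) =
      (∏ j, wal b (h.1 j) (p.1 j) * (starRingEnd ℂ) (wal b (h'.1 j) (p.1 j))) *
        ∏ j, ee (((h.2 j - h'.2 j : ℤ) : ℝ) * (p.2 j : ℝ)) := by
    intro p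
    have h2 : ∀ j, ee (((h.2 j - h'.2 j : ℤ) : ℝ) * (p.2 j : ℝ)) =
        ee (h.2 j * (p.2 j : ℝ)) * (starRingEnd ℂ) (ee (h'.2 j * (p.2 j : ℝ))) := by
      intro j
      rw [conj_ee, ← ee_add]
      congr 1
      push_cast
      ring
    simp only [basisFun, walVec, trigVec_eq_prod, map_mul, map_prod, h2, Finset.prod_mul_distrib]
    ring
  simp only [h1]
  have h3 := integral_prod_mul (μ := (volume : Measure (Fin s₁ → I01)))
    (ν := (volume : Measure (Fin s₂ → I01)))
    (fun x => ∏ j, wal b (h.1 j) (x j) * (starRingEnd ℂ) (wal b (h'.1 j) (x j)))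
    (fun y => ∏ j, ee (((h.2 j - h'.2 j : ℤ) : ℝ) * (y j : ℝ)))
  have h4 := integral_fintype_prod_eq_prod (𝕜 := ℂ) (μ := fun _ : Fin s₁ => (volume : Measure I01))
    (fun j (x : I01) => wal b (h.1 j) x * (starRingEnd ℂ) (wal b (h'.1 j) x))
  have h5 := integral_fintype_prod_eq_prod (𝕜 := ℂ) (μ := fun _ : Fin s₂ => (volume : Measure I01))
    (fun j (y : I01) => ee (((h.2 j - h'.2 j : ℤ) : ℝ) * (y : ℝ)))
  refine h3.trans ?_
  rw [volume_pi, volume_pi, h4, h5]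
  simp only [integral_wal_mul_conj hb, integral_ee_int]
  rw [Fintype.prod_ite_zero, Fintype.prod_ite_zero]
  simp only [Finset.prod_const_one, sub_eq_zero, ← funext_iff, ite_and, Prod.ext_iff]
  split_ifs <;> simp_all

lemma integral_basisFun {b : ℕ} (hb : 2 ≤ b) (h : Freq s₁ s₂) :
    ∫ p, basisFun b h p = if h = 0 then 1 else 0 := by
  rw [← integral_basisFun_mul_conj hb h 0]
  simp [basisFun_zero]

end

/-! ### Elements of the hybrid space and the initial error -/

section

lemma rWalsh_pos {b : ℕ} (hb : 2 ≤ b) (α : ℝ) {γ : ℝ} (hγ : 0 < γ) (k : ℕ) :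
    0 < rWalsh b α γ k := by
  have : (0 : ℝ) < b := by positivity
  unfold rWalsh
  split_ifs
  · exact one_pos
  · positivity

lemma rKorobov_pos (α : ℝ) {γ : ℝ} (hγ : 0 < γ) (l : ℤ) : 0 < rKorobov α γ l := by
  unfold rKorobov
  split_ifs with h
  · exact one_pos
  · have : (0 : ℝ) < |(l : ℝ)| := abs_pos.2 (by exact_mod_cast h)
    positivity

variable {P : Params} {s₁ s₂ : ℕ}

lemma decay_pos (hb : 2 ≤ P.b) (h₁ : ∀ j, 0 < P.γ₁ j) (h₂ : ∀ j, 0 < P.γ₂ j)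
    (h : Freq s₁ s₂) : 0 < decay P h :=
  mul_pos (Finset.prod_pos fun j _ => rWalsh_pos hb _ (h₁ j) _)
    (Finset.prod_pos fun j _ => rKorobov_pos _ (h₂ j) _)

lemma decay_zero : decay P (0 : Freq s₁ s₂) = 1 := by
  simp [decay, rWalsh, rKorobov]

lemma coeff_zero (b : ℕ) (f : Cube s₁ s₂ → ℂ) : coeff b f 0 = ∫ p, f p := by
  simp [coeff, basisFun_zero]

lemma coeff_sum_basisFun {b : ℕ} (hb : 2 ≤ b) (F : Finset (Freq s₁ s₂)) (a : Freq s₁ s₂ → ℂ)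
    (h : Freq s₁ s₂) :
    coeff b (fun p => ∑ h' ∈ F, a h' * basisFun b h' p) h = if h ∈ F then a h else 0 := by
  simp only [coeff, Finset.sum_mul, mul_assoc]
  rw [integral_finsetSum]
  · simp only [integral_const_mul, integral_basisFun_mul_conj hb]
    simp
  · intro h' _
    refine Integrable.const_mul ?_ _
    refine Integrable.of_bound (C := 1) ?_ (Eventually.of_forall fun p => ?_)
    · exact ((measurable_basisFun b h').mul
        (Complex.continuous_conj.measurable.comp (measurable_basisFun b h))).aestronglyMeasurable
    · simp [norm_basisFun]

/-- Finite linear combinations of basis functions belong to the hybrid space. -/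
lemma memHybrid_sum_basisFun (hb : 2 ≤ P.b) (F : Finset (Freq s₁ s₂)) (a : Freq s₁ s₂ → ℂ) :
    MemHybrid P (fun p => ∑ h ∈ F, a h * basisFun P.b h p) where
  integrable := integrable_finsetSum _ fun h _ => (integrable_basisFun P.b h).const_mul _
  summable_norm := by
    refine summable_of_ne_finset_zero (s := F) fun h hh => ?_
    rw [coeff_sum_basisFun hb, if_neg hh]
    simp
  hasSum p := by
    simp only [coeff_sum_basisFun hb]
    have h1 := hasSum_sum_of_ne_finset_zero (L := SummationFilter.unconditional _) (s := F)
      (f := fun h => (if h ∈ F then a h else 0) * basisFun P.b h p)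
      (fun h hh => by simp [hh])
    rw [Finset.sum_congr rfl fun h hh => by rw [if_pos hh]] at h1
    exact h1

lemma hybridNorm_sum_basisFun (hb : 2 ≤ P.b) (F : Finset (Freq s₁ s₂)) (a : Freq s₁ s₂ → ℂ) :
    hybridNorm P (fun p => ∑ h ∈ F, a h * basisFun P.b h p) =
      Real.sqrt (∑ h ∈ F, (decay P h)⁻¹ * ‖a h‖ ^ 2) := by
  unfold hybridNorm
  simp only [coeff_sum_basisFun hb]
  rw [tsum_eq_sum (s := F) fun h hh => by simp [hh]]
  congr 1
  exact Finset.sum_congr rfl fun h hh => by rw [if_pos hh]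

lemma tsum_le_one_of_mem_unitBall {f : Cube s₁ s₂ → ℂ} (hf : f ∈ unitBall P s₁ s₂) :
    ∑' h, (decay P h)⁻¹ * ‖coeff P.b f h‖ ^ 2 ≤ 1 := by
  have h1 := hf.2
  rw [hybridNorm, Real.sqrt_le_left one_pos.le] at h1
  simpa using h1

/-- The initial error is one. -/
lemma initError_eq_one (hb : 2 ≤ P.b) (h₁ : ∀ j, 0 < P.γ₁ j) (h₂ : ∀ j, 0 < P.γ₂ j) :
    initError P s₁ s₂ = 1 := by
  apply le_antisymm
  · refine iSup₂_le fun f hf => ?_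
    have h3 : (decay P 0)⁻¹ * ‖coeff P.b f 0‖ ^ 2 ≤ 1 :=
      (hf.1.summable_norm.le_tsum (0 : Freq s₁ s₂) fun h _ =>
        mul_nonneg (inv_nonneg.2 (decay_pos hb h₁ h₂ h).le) (sq_nonneg _)).trans
        (tsum_le_one_of_mem_unitBall hf)
    rw [decay_zero, inv_one, one_mul, coeff_zero, sq_le_one_iff₀ (norm_nonneg _)] at h3
    rw [← ofReal_norm, ← ENNReal.ofReal_one]
    exact ENNReal.ofReal_le_ofReal h3
  -- The constant function 1 attains the bound.
  · have hf : (fun p : Cube s₁ s₂ => ∑ h ∈ ({0} : Finset (Freq s₁ s₂)),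
        (1 : ℂ) * basisFun P.b h p) ∈ unitBall P s₁ s₂ := by
      refine ⟨memHybrid_sum_basisFun hb {0} fun _ => 1, ?_⟩
      rw [hybridNorm_sum_basisFun hb {0} fun _ => 1]
      simp [decay_zero]
    have h3 := le_iSup₂ (f := fun (f : Cube s₁ s₂ → ℂ) (_ : f ∈ unitBall P s₁ s₂) =>
      ‖∫ p, f p‖ₑ) _ hf
    simpa [initError, basisFun_zero] using h3

end

/-! ### Upper bound: averaging over the points -/

section

variable {P : Params} {s₁ s₂ : ℕ}

/-- The part of the decay outside the frequency zero. -/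
noncomputable def decayNonzero (P : Params) {s₁ s₂ : ℕ} (h : Freq s₁ s₂) : ℝ := if h = 0 then 0 else decay P h

lemma decayNonzero_nonneg (hb : 2 ≤ P.b) (h₁ : ∀ j, 0 < P.γ₁ j) (h₂ : ∀ j, 0 < P.γ₂ j)
    (h : Freq s₁ s₂) : 0 ≤ decayNonzero P h := by
  unfold decayNonzero
  split_ifs
  · exact le_rfl
  · exact (decay_pos hb h₁ h₂ h).le

lemma decayNonzero_le (hb : 2 ≤ P.b) (h₁ : ∀ j, 0 < P.γ₁ j) (h₂ : ∀ j, 0 < P.γ₂ j)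
    (h : Freq s₁ s₂) : decayNonzero P h ≤ decay P h := by
  unfold decayNonzero
  split_ifs
  · exact (decay_pos hb h₁ h₂ h).le
  · exact le_rfl

lemma qmc_basisFun_zero {N : ℕ} (hN : 1 ≤ N) (b : ℕ) (S : Fin N → Cube s₁ s₂) :
    qmc S (basisFun b 0) = 1 := by
  have : (N : ℂ) ≠ 0 := by exact_mod_cast (by omega : N ≠ 0)
  simp [qmc, basisFun_zero, this]

/-- The error of a QMC rule for functions in the unit ball, by the Cauchy-Schwarz inequality. -/
lemma norm_integral_sub_qmc_le (hb : 2 ≤ P.b) (h₁ : ∀ j, 0 < P.γ₁ j) (h₂ : ∀ j, 0 < P.γ₂ j)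
    {N : ℕ} (hN : 1 ≤ N) (S : Fin N → Cube s₁ s₂) {B : ℝ}
    (hB : ∀ u : Finset (Freq s₁ s₂),
      ∑ h ∈ u, decayNonzero P h * ‖qmc S (basisFun P.b h)‖ ^ 2 ≤ B)
    {f : Cube s₁ s₂ → ℂ} (hf : f ∈ unitBall P s₁ s₂) :
    ‖(∫ p, f p) - qmc S f‖ ≤ Real.sqrt B := by
  have hsum : HasSum (fun h : Freq s₁ s₂ => coeff P.b f h * qmc S (basisFun P.b h)) (qmc S f) := by
    have h3 := (hasSum_sum (s := Finset.univ) fun (n : Fin N) _ => hf.1.hasSum (S n)).mul_left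
      (1 / (N : ℂ))
    have h4 : (fun h : Freq s₁ s₂ => coeff P.b f h * qmc S (basisFun P.b h)) =
        fun h => 1 / (N : ℂ) * ∑ n, coeff P.b f h * basisFun P.b h (S n) := by
      funext h
      rw [qmc, ← Finset.mul_sum]
      ring
    rw [h4]
    exact h3
  -- The integral is written as a series supported at frequency zero, where it cancels the
  -- corresponding term of the rule. Bounding finite partial sums of the difference is then enough.
  have hdiff := (hasSum_ite_eq (0 : Freq s₁ s₂) (∫ p, f p)).sub hsum
  refine le_of_tendsto hdiff.norm (Eventually.of_forall fun u => ?_)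
  -- Cauchy–Schwarz splitting: `g` carries the norm of f, `v` the quality of the points.
  set g : Freq s₁ s₂ → ℝ := fun h => Real.sqrt (decay P h)⁻¹ * ‖coeff P.b f h‖ with hg
  set v : Freq s₁ s₂ → ℝ :=
    fun h => Real.sqrt (decayNonzero P h) * ‖qmc S (basisFun P.b h)‖ with hv
  have hterm : ∀ h : Freq s₁ s₂, ‖(if h = 0 then ∫ p, f p else 0) -
      coeff P.b f h * qmc S (basisFun P.b h)‖ ≤ g h * v h := by
    intro h
    by_cases h0 : h = 0
    · subst h0
      simp [qmc_basisFun_zero hN, coeff_zero, hg, hv, decayNonzero]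
    · have hd := decay_pos hb h₁ h₂ h
      have h4 : Real.sqrt (decay P h)⁻¹ * Real.sqrt (decay P h) = 1 := by
        rw [← Real.sqrt_mul (inv_nonneg.2 hd.le), inv_mul_cancel₀ hd.ne', Real.sqrt_one]
      simp only [h0, if_false, zero_sub, norm_neg, norm_mul, hg, hv, decayNonzero]
      apply le_of_eq
      linear_combination (-(‖coeff P.b f h‖ * ‖qmc S (basisFun P.b h)‖)) * h4
  have hg2 : ∑ h ∈ u, g h ^ 2 ≤ 1 := by
    refine le_trans ?_ (tsum_le_one_of_mem_unitBall hf)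
    have h5 : ∀ h : Freq s₁ s₂, g h ^ 2 = (decay P h)⁻¹ * ‖coeff P.b f h‖ ^ 2 := fun h => by
      rw [hg, mul_pow, Real.sq_sqrt (inv_nonneg.2 (decay_pos hb h₁ h₂ h).le)]
    simp only [h5]
    exact hf.1.summable_norm.sum_le_tsum u fun h _ =>
      mul_nonneg (inv_nonneg.2 (decay_pos hb h₁ h₂ h).le) (sq_nonneg _)
  have hv2 : ∑ h ∈ u, v h ^ 2 ≤ B := by
    refine le_trans (le_of_eq ?_) (hB u)
    refine Finset.sum_congr rfl fun h _ => ?_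
    rw [hv, mul_pow, Real.sq_sqrt (decayNonzero_nonneg hb h₁ h₂ h)]
  refine (norm_sum_le _ _).trans ((Finset.sum_le_sum fun h _ => hterm h).trans ?_)
  apply Real.le_sqrt_of_sq_le
  refine (Finset.sum_mul_sq_le_sq_mul_sq u g v).trans ?_
  calc (∑ h ∈ u, g h ^ 2) * ∑ h ∈ u, v h ^ 2 ≤ 1 * ∑ h ∈ u, v h ^ 2 :=
        mul_le_mul_of_nonneg_right hg2 (Finset.sum_nonneg fun h _ => sq_nonneg _)
    _ ≤ B := by rwa [one_mul]

/-- The cross term has mean zero because h ≠ 0. Thus a uniformly random new point raises the squared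
character sum by exactly one on average. -/
lemma integral_norm_add_basisFun_sq {b : ℕ} (hb : 2 ≤ b) {h : Freq s₁ s₂} (h0 : h ≠ 0) (T : ℂ) :
    ∫ p, ‖T + basisFun b h p‖ ^ 2 = ‖T‖ ^ 2 + 1 := by
  have h1 : ∀ p, ‖T + basisFun b h p‖ ^ 2 =
      ((‖T‖ ^ 2 + 1 : ℝ)) + 2 * ((starRingEnd ℂ) T * basisFun b h p).re := by
    intro p
    have h2 : ‖basisFun b h p‖ ^ 2 = 1 := by simp [norm_basisFun]
    rw [← Complex.normSq_eq_norm_sq] at h2 ⊢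
    rw [← Complex.normSq_eq_norm_sq, Complex.normSq_add, h2]
    rw [← Complex.conj_re, map_mul, Complex.conj_conj]
  have hint : Integrable fun p => (starRingEnd ℂ) T * basisFun b h p :=
    (integrable_basisFun b h).const_mul _
  have h3 : ∫ p, ((starRingEnd ℂ) T * basisFun b h p).re = 0 := by
    have := Complex.reCLM.integral_comp_comm hint
    simp only [Complex.reCLM_apply] at this
    rw [this, integral_const_mul, integral_basisFun hb, if_neg h0]
    simp
  have hre : Integrable fun p => 2 * ((starRingEnd ℂ) T * basisFun b h p).re :=
    (Complex.reCLM.integrable_comp hint).const_mul 2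
  simp only [h1]
  rw [integral_add (integrable_const _) hre, integral_const_mul, h3]
  simp

/-- Points chosen one after another keep the weighted sum of squares below its mean value. -/
lemma exists_points {b : ℕ} (hb : 2 ≤ b) {g : Freq s₁ s₂ → ℝ} (hg : ∀ h, 0 ≤ g h) (hg0 : g 0 = 0)
    (hsum : Summable g) (N : ℕ) :
    ∃ S : Fin N → Cube s₁ s₂, ∑' h, g h * ‖∑ n, basisFun b h (S n)‖ ^ 2 ≤ N * ∑' h, g h := by
  induction N with
  | zero => exact ⟨Fin.elim0, by simp⟩
  | succ N ih =>
    obtain ⟨S, hS⟩ := ih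
    set T : Freq s₁ s₂ → ℂ := fun h => ∑ n, basisFun b h (S n) with hT
    have hTN : ∀ h, ‖T h‖ ≤ N := fun h => by
      refine (norm_sum_le _ _).trans ?_
      simp [norm_basisFun]
    have hbd : ∀ h p, ‖T h + basisFun b h p‖ ≤ N + 1 := fun h p =>
      (norm_add_le _ _).trans (add_le_add (hTN h) (norm_basisFun b h p).le)
    have hS1 : Summable fun h => g h * ‖T h‖ ^ 2 :=
      Summable.of_nonneg_of_le (fun h => mul_nonneg (hg h) (sq_nonneg _))
        (fun h => mul_le_mul_of_nonneg_left (pow_le_pow_left₀ (norm_nonneg _) (hTN h) 2) (hg h))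
        (hsum.mul_right ((N : ℝ) ^ 2))
    have hS2 : ∀ p, Summable fun h => g h * ‖T h + basisFun b h p‖ ^ 2 := fun p =>
      Summable.of_nonneg_of_le (fun h => mul_nonneg (hg h) (sq_nonneg _))
        (fun h => mul_le_mul_of_nonneg_left (pow_le_pow_left₀ (norm_nonneg _) (hbd h p) 2) (hg h))
        (hsum.mul_right ((N + 1 : ℝ) ^ 2))
    have hmeas : ∀ h, Measurable fun p => g h * ‖T h + basisFun b h p‖ ^ 2 := fun h =>
      (((measurable_basisFun b h).const_add _).norm.pow_const 2).const_mul _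
    have hint : ∀ h, ∫⁻ p, ENNReal.ofReal (g h * ‖T h + basisFun b h p‖ ^ 2) =
        ENNReal.ofReal (g h * ‖T h‖ ^ 2 + g h) := by
      intro h
      rw [← ofReal_integral_eq_lintegral_ofReal]
      · rw [integral_const_mul]
        by_cases h0 : h = 0
        · simp [h0, hg0]
        · rw [integral_norm_add_basisFun_sq hb h0, mul_add, mul_one]
      · refine Integrable.of_bound (hmeas h).aestronglyMeasurable (g h * (N + 1) ^ 2)
          (Eventually.of_forall fun p => ?_)
        rw [Real.norm_of_nonneg (mul_nonneg (hg h) (sq_nonneg _))]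
        exact mul_le_mul_of_nonneg_left (pow_le_pow_left₀ (norm_nonneg _) (hbd h p) 2) (hg h)
      · exact Eventually.of_forall fun p => mul_nonneg (hg h) (sq_nonneg _)
    -- Some p does not exceed the mean, and the mean raises the h-th term by exactly `g h`. In
    -- `ℝ≥0∞` sum and integral may be interchanged without integrability conditions.
    obtain ⟨p, hp⟩ := exists_le_lintegral (μ := (volume : Measure (Cube s₁ s₂)))
      (f := fun p => ∑' h, ENNReal.ofReal (g h * ‖T h + basisFun b h p‖ ^ 2))
      (Measurable.tsum fun h => (hmeas h).ennreal_ofReal).aemeasurable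
    rw [lintegral_tsum fun h => (hmeas h).ennreal_ofReal.aemeasurable] at hp
    simp only [hint] at hp
    rw [← ENNReal.ofReal_tsum_of_nonneg (fun h => mul_nonneg (hg h) (sq_nonneg _)) (hS2 p),
      ← ENNReal.ofReal_tsum_of_nonneg
        (fun h => add_nonneg (mul_nonneg (hg h) (sq_nonneg _)) (hg h)) (hS1.add hsum),
      ENNReal.ofReal_le_ofReal_iff (tsum_nonneg fun h =>
        add_nonneg (mul_nonneg (hg h) (sq_nonneg _)) (hg h)), hS1.tsum_add hsum] at hp
    refine ⟨Fin.snoc S p, ?_⟩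
    simp only [Fin.sum_univ_castSucc, Fin.snoc_castSucc, Fin.snoc_last]
    push_cast
    linarith

/-- The points of `exists_points` bound the squared error by N⁻² · N · ∑ r(h). -/
lemma minError_le (hb : 2 ≤ P.b) (h₁ : ∀ j, 0 < P.γ₁ j) (h₂ : ∀ j, 0 < P.γ₂ j)
    {N : ℕ} (hN : 1 ≤ N) (hsum : Summable (decayNonzero P (s₁ := s₁) (s₂ := s₂))) :
    minError P s₁ s₂ N ≤
      ENNReal.ofReal (Real.sqrt ((∑' h : Freq s₁ s₂, decayNonzero P h) / N)) := by
  have hg := decayNonzero_nonneg hb h₁ h₂ (s₁ := s₁) (s₂ := s₂)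
  obtain ⟨S, hS⟩ := exists_points hb hg (by simp [decayNonzero]) hsum N
  refine iInf_le_of_le S (iSup₂_le fun f hf => ?_)
  rw [← ofReal_norm]
  refine ENNReal.ofReal_le_ofReal (norm_integral_sub_qmc_le hb h₁ h₂ hN S (fun u => ?_) hf)
  have hN' : (0 : ℝ) < N := by exact_mod_cast hN
  have h3 : ∀ h : Freq s₁ s₂, decayNonzero P h * ‖qmc S (basisFun P.b h)‖ ^ 2 =
      (1 / (N : ℝ) ^ 2) * (decayNonzero P h * ‖∑ n, basisFun P.b h (S n)‖ ^ 2) := by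
    intro h
    rw [qmc, norm_mul, mul_pow]
    simp
    ring
  have hs : Summable fun h => decayNonzero P h * ‖∑ n, basisFun P.b h (S n)‖ ^ 2 := by
    refine Summable.of_nonneg_of_le (fun h => mul_nonneg (hg h) (sq_nonneg _))
      (fun h => mul_le_mul_of_nonneg_left (pow_le_pow_left₀ (norm_nonneg _)
        ((norm_sum_le _ _).trans ?_) 2) (hg h)) (hsum.mul_right ((N : ℝ) ^ 2))
    simp [norm_basisFun]
  simp only [h3, ← Finset.mul_sum]
  calc _ ≤ 1 / (N : ℝ) ^ 2 * (N * ∑' h : Freq s₁ s₂, decayNonzero P h) := by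
        gcongr
        exact (hs.sum_le_tsum u fun h _ => mul_nonneg (hg h) (sq_nonneg _)).trans hS
    _ = _ := by field_simp

/-! ### Upper bound: summing the decay -/

lemma summable_natCast_rpow_neg {α : ℝ} (hα : 1 < α) : Summable fun k : ℕ => (k : ℝ) ^ (-α) :=
  Real.summable_nat_rpow.2 (by linarith)

/-- From k < b^(⌊log_b k⌋ + 1) the Walsh decay is dominated by bᵅ k⁻ᵅ, which is summable for α > 1.
-/
lemma rWalsh_le {b : ℕ} (hb : 2 ≤ b) {α : ℝ} (hα : 1 < α) {γ : ℝ} (hγ : 0 < γ) (k : ℕ) :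
    rWalsh b α γ k ≤ (if k = 0 then 1 else 0) + γ * ((b : ℝ) ^ α * (k : ℝ) ^ (-α)) := by
  unfold rWalsh
  split_ifs with h
  · have : (0 : ℝ) ≤ γ * ((b : ℝ) ^ α * (k : ℝ) ^ (-α)) := by positivity
    linarith
  · rw [zero_add]
    gcongr
    have hb0 : (0 : ℝ) < b := by positivity
    have hk : (0 : ℝ) < k := by exact_mod_cast Nat.pos_of_ne_zero h
    have h1 : (k : ℝ) ≤ (b : ℝ) ^ ((Nat.log b k : ℝ) + 1) := by
      have := (Nat.lt_pow_succ_log_self (by omega : 1 < b) k).le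
      have h2 : (k : ℝ) ≤ (b : ℝ) ^ (Nat.log b k + 1) := by exact_mod_cast this
      rwa [← Real.rpow_natCast, Nat.cast_add, Nat.cast_one] at h2
    have h3 : ((b : ℝ) ^ ((Nat.log b k : ℝ) + 1)) ^ (-α) ≤ (k : ℝ) ^ (-α) :=
      Real.rpow_le_rpow_of_nonpos hk h1 (by linarith)
    rw [← Real.rpow_mul hb0.le] at h3
    calc (b : ℝ) ^ (-(α * (Nat.log b k : ℝ)))
        = (b : ℝ) ^ α * (b : ℝ) ^ (((Nat.log b k : ℝ) + 1) * -α) := by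
          rw [← Real.rpow_add hb0]
          congr 1
          ring
      _ ≤ _ := by gcongr

/-- Index zero contributes at most 1 and the rest at most γ times a convergent series; then 1 + x ≤
exp x turns products over coordinates into sums of weights. -/
lemma sum_rWalsh_le {b : ℕ} (hb : 2 ≤ b) {α : ℝ} (hα : 1 < α) {γ : ℝ} (hγ : 0 < γ)
    (u : Finset ℕ) :
    ∑ k ∈ u, rWalsh b α γ k ≤ Real.exp ((∑' k : ℕ, (b : ℝ) ^ α * (k : ℝ) ^ (-α)) * γ) := by
  calc ∑ k ∈ u, rWalsh b α γ k
      ≤ ∑ k ∈ u, ((if k = 0 then 1 else 0) + γ * ((b : ℝ) ^ α * (k : ℝ) ^ (-α))) :=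
        Finset.sum_le_sum fun k _ => rWalsh_le hb hα hγ k
    _ = (if 0 ∈ u then 1 else 0) + γ * ∑ k ∈ u, (b : ℝ) ^ α * (k : ℝ) ^ (-α) := by
        rw [Finset.sum_add_distrib, Finset.mul_sum, Finset.sum_ite_eq']
    _ ≤ 1 + γ * ∑' k : ℕ, (b : ℝ) ^ α * (k : ℝ) ^ (-α) := by
        gcongr
        · split_ifs <;> simp
        · exact ((summable_natCast_rpow_neg hα).mul_left _).sum_le_tsum u fun k _ => by positivity
    _ ≤ _ := by
        have := Real.add_one_le_exp ((∑' k : ℕ, (b : ℝ) ^ α * (k : ℝ) ^ (-α)) * γ)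
        linarith

lemma sum_rKorobov_le {α : ℝ} (hα : 1 < α) {γ : ℝ} (hγ : 0 < γ) (u : Finset ℤ) :
    ∑ l ∈ u, rKorobov α γ l ≤ Real.exp ((∑' l : ℤ, |(l : ℝ)| ^ (-α)) * γ) := by
  have h1 : ∀ l : ℤ, rKorobov α γ l ≤ (if l = 0 then 1 else 0) + γ * |(l : ℝ)| ^ (-α) := by
    intro l
    unfold rKorobov
    split_ifs
    · have : (0 : ℝ) ≤ γ * |(l : ℝ)| ^ (-α) := by positivity
      linarith
    · rw [zero_add]
  calc ∑ l ∈ u, rKorobov α γ l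
      ≤ ∑ l ∈ u, ((if l = 0 then 1 else 0) + γ * |(l : ℝ)| ^ (-α)) :=
        Finset.sum_le_sum fun l _ => h1 l
    _ = (if 0 ∈ u then 1 else 0) + γ * ∑ l ∈ u, |(l : ℝ)| ^ (-α) := by
        rw [Finset.sum_add_distrib, Finset.mul_sum, Finset.sum_ite_eq']
    _ ≤ 1 + γ * ∑' l : ℤ, |(l : ℝ)| ^ (-α) := by
        gcongr
        · split_ifs <;> simp
        · exact (Real.summable_abs_int_rpow hα).sum_le_tsum u fun l _ => by positivity
    _ ≤ _ := by
        have := Real.add_one_le_exp ((∑' l : ℤ, |(l : ℝ)| ^ (-α)) * γ)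
        linarith

/-- Sums of products over a box of frequencies factorize. -/
lemma sum_piFinset_product {R : Type*} [CommSemiring R] (A : Fin s₁ → Finset ℕ)
    (B : Fin s₂ → Finset ℤ) (F : Fin s₁ → ℕ → R) (G : Fin s₂ → ℤ → R) :
    ∑ h ∈ Fintype.piFinset A ×ˢ Fintype.piFinset B,
        (∏ j, F j (h.1 j)) * ∏ j, G j (h.2 j) =
      (∏ j, ∑ k ∈ A j, F j k) * ∏ j, ∑ l ∈ B j, G j l := by
  rw [Finset.prod_univ_sum, Finset.prod_univ_sum, Finset.sum_mul_sum, Finset.sum_product]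

/-- Finite sums of the decay are bounded exponentially in the sums of the weights. -/
lemma exists_sum_decay_le (hb : 2 ≤ P.b) (hα₁ : 1 < P.α₁) (hα₂ : 1 < P.α₂)
    (h₁ : ∀ j, 0 < P.γ₁ j) (h₂ : ∀ j, 0 < P.γ₂ j) :
    ∃ μ : ℝ, 0 ≤ μ ∧ ∀ (s₁ s₂ : ℕ) (u : Finset (Freq s₁ s₂)), ∑ h ∈ u, decay P h ≤
      Real.exp (μ * ((∑ j ∈ Finset.range s₁, P.γ₁ j) + ∑ j ∈ Finset.range s₂, P.γ₂ j)) := by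
  set μ₁ : ℝ := ∑' k : ℕ, (P.b : ℝ) ^ P.α₁ * (k : ℝ) ^ (-P.α₁) with hμ₁
  set μ₂ : ℝ := ∑' l : ℤ, |(l : ℝ)| ^ (-P.α₂) with hμ₂
  have hμ₁0 : 0 ≤ μ₁ := tsum_nonneg fun k => by positivity
  have hμ₂0 : 0 ≤ μ₂ := tsum_nonneg fun k => by positivity
  refine ⟨μ₁ + μ₂, by positivity, fun s₁ s₂ u => ?_⟩
  -- The coordinate projections of `u` span a finite box containing it, over which the sum
  -- factorizes.
  set A : Fin s₁ → Finset ℕ := fun j => u.image fun h => h.1 j with hA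
  set B : Fin s₂ → Finset ℤ := fun j => u.image fun h => h.2 j with hB
  have hsub : u ⊆ Fintype.piFinset A ×ˢ Fintype.piFinset B := by
    intro h hh
    simp only [Finset.mem_product, Fintype.mem_piFinset, hA, hB, Finset.mem_image]
    exact ⟨fun j => ⟨h, hh, rfl⟩, fun j => ⟨h, hh, rfl⟩⟩
  have hS₁ : 0 ≤ ∑ j ∈ Finset.range s₁, P.γ₁ j := Finset.sum_nonneg fun j _ => (h₁ j).le
  have hS₂ : 0 ≤ ∑ j ∈ Finset.range s₂, P.γ₂ j := Finset.sum_nonneg fun j _ => (h₂ j).le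
  calc ∑ h ∈ u, decay P h
      ≤ ∑ h ∈ Fintype.piFinset A ×ˢ Fintype.piFinset B, decay P h :=
        Finset.sum_le_sum_of_subset_of_nonneg hsub fun h _ _ => (decay_pos hb h₁ h₂ h).le
    _ = (∏ j, ∑ k ∈ A j, rWalsh P.b P.α₁ (P.γ₁ j) k) *
          ∏ j, ∑ l ∈ B j, rKorobov P.α₂ (P.γ₂ j) l := sum_piFinset_product _ _ _ _
    _ ≤ (∏ j : Fin s₁, Real.exp (μ₁ * P.γ₁ j)) * ∏ j : Fin s₂, Real.exp (μ₂ * P.γ₂ j) := by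
        refine mul_le_mul
          (Finset.prod_le_prod (fun j _ => Finset.sum_nonneg fun k _ =>
            (rWalsh_pos hb _ (h₁ j) k).le) fun j _ => sum_rWalsh_le hb hα₁ (h₁ j) _)
          (Finset.prod_le_prod (fun j _ => Finset.sum_nonneg fun l _ =>
            (rKorobov_pos _ (h₂ j) l).le) fun j _ => sum_rKorobov_le hα₂ (h₂ j) _)
          (Finset.prod_nonneg fun j _ => Finset.sum_nonneg fun l _ =>
            (rKorobov_pos _ (h₂ j) l).le)
          (Finset.prod_nonneg fun j _ => (Real.exp_pos _).le)
    _ = Real.exp (μ₁ * (∑ j ∈ Finset.range s₁, P.γ₁ j) +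
          μ₂ * ∑ j ∈ Finset.range s₂, P.γ₂ j) := by
        rw [← Real.exp_sum, ← Real.exp_sum, ← Real.exp_add, ← Finset.mul_sum, ← Finset.mul_sum,
          Fin.sum_univ_eq_sum_range, Fin.sum_univ_eq_sum_range]
    _ ≤ _ := by
        apply Real.exp_le_exp.2
        nlinarith [mul_nonneg hμ₁0 hS₂, mul_nonneg hμ₂0 hS₁]

/-- Upper bound for the information complexity; in particular the set of admissible numbers of
points is nonempty. -/
theorem exists_infoComplexity_le (hb : 2 ≤ P.b) (hα₁ : 1 < P.α₁) (hα₂ : 1 < P.α₂)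
    (h₁ : ∀ j, 0 < P.γ₁ j) (h₂ : ∀ j, 0 < P.γ₂ j) :
    ∃ μ : ℝ, 0 ≤ μ ∧ ∀ (s₁ s₂ : ℕ) (ε : ℝ), 0 < ε → ε ≤ 1 →
      (1 ≤ infoComplexity P ε s₁ s₂ ∧
        minError P s₁ s₂ (infoComplexity P ε s₁ s₂) ≤ ENNReal.ofReal ε) ∧
      (infoComplexity P ε s₁ s₂ : ℝ) ≤ 2 * ε ^ (-2 : ℝ) *
        Real.exp (μ * ((∑ j ∈ Finset.range s₁, P.γ₁ j) + ∑ j ∈ Finset.range s₂, P.γ₂ j)) := by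
  obtain ⟨μ, hμ, hsumle⟩ := exists_sum_decay_le hb hα₁ hα₂ h₁ h₂
  refine ⟨μ, hμ, fun s₁ s₂ ε hε hε1 => ?_⟩
  have hS₁ : 0 ≤ ∑ j ∈ Finset.range s₁, P.γ₁ j := Finset.sum_nonneg fun j _ => (h₁ j).le
  have hS₂ : 0 ≤ ∑ j ∈ Finset.range s₂, P.γ₂ j := Finset.sum_nonneg fun j _ => (h₂ j).le
  set D := Real.exp (μ * ((∑ j ∈ Finset.range s₁, P.γ₁ j) + ∑ j ∈ Finset.range s₂, P.γ₂ j))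
  have hD : 1 ≤ D := Real.one_le_exp (by positivity)
  have hle : ∀ u : Finset (Freq s₁ s₂), ∑ h ∈ u, decayNonzero P h ≤ D := fun u =>
    (Finset.sum_le_sum fun h _ => decayNonzero_le hb h₁ h₂ h).trans (hsumle s₁ s₂ u)
  have hnn := decayNonzero_nonneg hb h₁ h₂ (s₁ := s₁) (s₂ := s₂)
  have hsum : Summable (decayNonzero P (s₁ := s₁) (s₂ := s₂)) := summable_of_sum_le hnn hle
  have hrpow : ε ^ (-2 : ℝ) = (ε ^ 2)⁻¹ := by
    rw [Real.rpow_neg hε.le]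
    norm_cast
  have hε2 : 1 ≤ ε ^ (-2 : ℝ) := by
    rw [hrpow]
    exact (one_le_inv₀ (by positivity)).2 (pow_le_one₀ hε.le hε1)
  have hprod : 1 ≤ ε ^ (-2 : ℝ) * D := one_le_mul_of_one_le_of_one_le hε2 hD
  -- The least integer making the error bound √(D/N) at most ε.
  set M := ⌈ε ^ (-2 : ℝ) * D⌉₊ with hM
  have hM1 : 1 ≤ M := Nat.one_le_ceil_iff.2 (by linarith)
  have hM0 : (0 : ℝ) < M := by exact_mod_cast hM1
  have hMle : ε ^ (-2 : ℝ) * D ≤ M := Nat.le_ceil _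
  have hmem : M ∈ {N : ℕ | 1 ≤ N ∧
      minError P s₁ s₂ N ≤ ENNReal.ofReal ε * initError P s₁ s₂} := by
    refine ⟨hM1, ?_⟩
    rw [initError_eq_one hb h₁ h₂, mul_one]
    refine (minError_le hb h₁ h₂ hM1 hsum).trans (ENNReal.ofReal_le_ofReal ?_)
    rw [Real.sqrt_le_left hε.le, div_le_iff₀ hM0]
    refine (hsum.tsum_le_of_sum_le hle).trans ?_
    rw [hrpow, inv_mul_le_iff₀ (by positivity)] at hMle
    exact hMle
  -- The admissible set is nonempty, so the infimum is attained and is not the default value 0 of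
  -- `sInf ∅`.
  have h5 := Nat.sInf_mem ⟨M, hmem⟩
  refine ⟨⟨h5.1, ?_⟩, ?_⟩
  · exact h5.2.trans_eq (by rw [initError_eq_one hb h₁ h₂, mul_one])
  · have h6 : (infoComplexity P ε s₁ s₂ : ℝ) ≤ M := by exact_mod_cast Nat.sInf_le hmem
    -- Rounding up costs less than 1 ≤ ε⁻²D, whence the factor 2.
    have h7 : (M : ℝ) < ε ^ (-2 : ℝ) * D + 1 := Nat.ceil_lt_add_one (by linarith)
    linarith

end

/-! ### Lower bound: a nonnegative truncated kernel -/

section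

variable {P : Params} {s₁ s₂ : ℕ}

lemma wal_of_lt {b k : ℕ} (hk : k < b) (x : ℝ) :
    wal b k x = ee (k * (realDigit b x 1 / b)) := by
  rw [wal, Nat.log_of_lt hk]
  simp only [zero_add, Finset.range_one, Finset.sum_singleton, natDigit, pow_zero, Nat.div_one,
    Nat.mod_eq_of_lt hk]
  congr 1
  ring

/-- The full character sum over k < b is b or 0 according to whether the first digits agree; the
term k = 0 is corrected from t to 1. The value is nonnegative for 0 ≤ t ≤ 1. -/
lemma sum_range_ite_wal {b : ℕ} (hb : 2 ≤ b) (t x y : ℝ) :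
    ∑ k ∈ Finset.range b, ((if k = 0 then 1 else t : ℝ) : ℂ) *
        (wal b k x * (starRingEnd ℂ) (wal b k y)) =
      ((1 - t + t * (if (b : ℤ) ∣ (realDigit b x 1 : ℤ) - realDigit b y 1 then (b : ℝ) else 0) :
        ℝ) : ℂ) := by
  have hb0 : 0 < b := by omega
  have h1 : ∀ k ∈ Finset.range b, ((if k = 0 then 1 else t : ℝ) : ℂ) *
      (wal b k x * (starRingEnd ℂ) (wal b k y)) =
      (if k = 0 then (1 - t : ℂ) else 0) +
        t * ee (k * (((realDigit b x 1 - realDigit b y 1 : ℤ) : ℝ) / b)) := by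
    intro k hk
    have h2 : wal b k x * (starRingEnd ℂ) (wal b k y) =
        ee (k * (((realDigit b x 1 - realDigit b y 1 : ℤ) : ℝ) / b)) := by
      rw [wal_of_lt (Finset.mem_range.1 hk), wal_of_lt (Finset.mem_range.1 hk), conj_ee, ← ee_add]
      congr 1
      push_cast
      ring
    rw [h2]
    split_ifs with h
    · simp [h, ee_zero]
    · simp
  rw [Finset.sum_congr rfl h1, Finset.sum_add_distrib, Finset.sum_ite_eq', ← Finset.mul_sum,
    sum_range_ee hb0, if_pos (Finset.mem_range.2 hb0)]
  split_ifs <;> push_cast <;> ring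

/-- The frequencies 1 and -1 combine to a cosine, so the value is nonnegative for 0 ≤ 2t ≤ 1. -/
lemma sum_ite_trig (t x y : ℝ) :
    ∑ l ∈ ({-1, 0, 1} : Finset ℤ), ((if l = 0 then 1 else t : ℝ) : ℂ) *
        (ee (l * x) * (starRingEnd ℂ) (ee (l * y))) =
      ((1 + t * (2 * Real.cos (2 * Real.pi * (x - y))) : ℝ) : ℂ) := by
  have h1 : ∀ l : ℤ, ee (l * x) * (starRingEnd ℂ) (ee (l * y)) = ee (l * (x - y)) := by
    intro l
    rw [conj_ee, ← ee_add]
    congr 1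
    ring
  have h2 : ee (x - y) + ee (-(x - y)) = 2 * Complex.cos (2 * Real.pi * (x - y)) := by
    rw [Complex.cos, ee, ee]
    push_cast
    have h3 : (2 * Real.pi * Complex.I * (x - y) : ℂ) = 2 * Real.pi * (x - y) * Complex.I := by
      ring
    have h4 : (2 * Real.pi * Complex.I * -(x - y) : ℂ) = -(2 * Real.pi * (x - y)) * Complex.I := by
      ring
    rw [h3, h4]
    ring
  simp only [h1]
  rw [Finset.sum_insert (by decide), Finset.sum_insert (by decide), Finset.sum_singleton]
  simp only [neg_eq_zero, one_ne_zero, if_false, if_true, Int.cast_neg, Int.cast_one, Int.cast_zero,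
    neg_mul, one_mul, zero_mul, ee_zero]
  push_cast
  rw [← h2]
  ring

/-- A box of low frequencies. -/
def lowFreq (b s₁ s₂ : ℕ) : Finset (Freq s₁ s₂) :=
  Fintype.piFinset (fun _ => Finset.range b) ×ˢ Fintype.piFinset fun _ => {-1, 0, 1}

/-- Reduced weights on the low frequencies, for which the truncated kernel is nonnegative. -/
def lowWeight (P : Params) (c : ℝ) {s₁ s₂ : ℕ} (h : Freq s₁ s₂) : ℝ :=
  (∏ j : Fin s₁, if h.1 j = 0 then 1 else c * P.γ₁ j) *
    ∏ j : Fin s₂, if h.2 j = 0 then 1 else c * P.γ₂ j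

/-- The truncated kernel of the reduced weights. -/
noncomputable def lowKernel (P : Params) (c : ℝ) {s₁ s₂ : ℕ} (p q : Cube s₁ s₂) : ℝ :=
  (∏ j : Fin s₁, (1 - c * P.γ₁ j + c * P.γ₁ j *
    (if (P.b : ℤ) ∣ (realDigit P.b (p.1 j) 1 : ℤ) - realDigit P.b (q.1 j) 1
      then (P.b : ℝ) else 0))) *
    ∏ j : Fin s₂, (1 + c * P.γ₂ j * (2 * Real.cos (2 * Real.pi * ((p.2 j : ℝ) - q.2 j))))

lemma sum_lowFreq (hb : 2 ≤ P.b) (c : ℝ) (p q : Cube s₁ s₂) :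
    ∑ h ∈ lowFreq P.b s₁ s₂, (lowWeight P c h : ℂ) *
      (basisFun P.b h p * (starRingEnd ℂ) (basisFun P.b h q)) = lowKernel P c p q := by
  set G₁ : Fin s₁ → ℕ → ℂ := fun j k => ((if k = 0 then 1 else c * P.γ₁ j : ℝ) : ℂ) *
    (wal P.b k (p.1 j) * (starRingEnd ℂ) (wal P.b k (q.1 j))) with hG₁
  set G₂ : Fin s₂ → ℤ → ℂ := fun j l => ((if l = 0 then 1 else c * P.γ₂ j : ℝ) : ℂ) *
    (ee (l * (p.2 j : ℝ)) * (starRingEnd ℂ) (ee (l * (q.2 j : ℝ)))) with hG₂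
  have h1 : ∀ h : Freq s₁ s₂, (lowWeight P c h : ℂ) *
      (basisFun P.b h p * (starRingEnd ℂ) (basisFun P.b h q)) =
      (∏ j, G₁ j (h.1 j)) * ∏ j, G₂ j (h.2 j) := by
    intro h
    simp only [hG₁, hG₂, lowWeight, basisFun, walVec, trigVec_eq_prod, map_mul, map_prod,
      Complex.ofReal_mul, Complex.ofReal_prod, Finset.prod_mul_distrib]
    ring
  rw [Finset.sum_congr rfl fun h _ => h1 h, lowFreq,
    sum_piFinset_product (fun _ => Finset.range P.b) (fun _ => {-1, 0, 1}) G₁ G₂, lowKernel]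
  simp only [hG₁, hG₂, sum_range_ite_wal hb, sum_ite_trig]
  push_cast
  rfl

/-- The conditions on the factor `c` which make the truncated kernel nonnegative. -/
structure IsReduction (P : Params) (c : ℝ) : Prop where
  pos : 0 < c
  le_one : c ≤ 1
  walsh : ∀ j, c * P.γ₁ j ≤ 1
  korobov : ∀ j, 2 * (c * P.γ₂ j) ≤ 1

/-- Each Walsh factor is at least 1 - cγ and each Korobov factor at least 1 - 2cγ. -/
lemma lowKernel_nonneg {c : ℝ} (hc : IsReduction P c) (h₁ : ∀ j, 0 < P.γ₁ j)
    (h₂ : ∀ j, 0 < P.γ₂ j) (p q : Cube s₁ s₂) : 0 ≤ lowKernel P c p q := by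
  refine mul_nonneg (Finset.prod_nonneg fun j _ => ?_) (Finset.prod_nonneg fun j _ => ?_)
  · have h3 : 0 ≤ c * P.γ₁ j := mul_nonneg hc.pos.le (h₁ j).le
    have h4 := hc.walsh j
    have h5 : 0 ≤ c * P.γ₁ j *
        (if (P.b : ℤ) ∣ (realDigit P.b (p.1 j) 1 : ℤ) - realDigit P.b (q.1 j) 1
          then (P.b : ℝ) else 0) := by
      refine mul_nonneg h3 ?_
      split_ifs <;> positivity
    linarith
  · have h3 : 0 ≤ c * P.γ₂ j := mul_nonneg hc.pos.le (h₂ j).le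
    have h4 := hc.korobov j
    nlinarith [Real.neg_one_le_cos (2 * Real.pi * ((p.2 j : ℝ) - q.2 j))]

/-- Combines exp(-x/2) ≥ 1 - x/2 with (1 + x)(1 - x/2) ≥ 1, valid on [0, 1]. -/
lemma exp_half_le_one_add {x : ℝ} (h0 : 0 ≤ x) (h1 : x ≤ 1) : Real.exp (x / 2) ≤ 1 + x := by
  have h2 : 1 - x / 2 ≤ Real.exp (-(x / 2)) := by
    have := Real.add_one_le_exp (-(x / 2))
    linarith
  have h3 : Real.exp (x / 2) * Real.exp (-(x / 2)) = 1 := by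
    rw [← Real.exp_add]
    simp
  have h4 := Real.exp_pos (x / 2)
  have h5 : Real.exp (x / 2) * (1 - x / 2) ≤ 1 :=
    (mul_le_mul_of_nonneg_left h2 h4.le).trans h3.le
  nlinarith

/-- On the diagonal the factors are 1 + (b - 1)cγ and 1 + 2cγ, both at least 1 + cγ as b ≥ 2. -/
lemma exp_le_lowKernel_self (hb : 2 ≤ P.b) {c : ℝ} (hc : IsReduction P c) (h₁ : ∀ j, 0 < P.γ₁ j)
    (h₂ : ∀ j, 0 < P.γ₂ j) (p : Cube s₁ s₂) :
    Real.exp (c / 2 * ((∑ j ∈ Finset.range s₁, P.γ₁ j) + ∑ j ∈ Finset.range s₂, P.γ₂ j)) ≤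
      lowKernel P c p p := by
  rw [mul_add, Real.exp_add, Finset.mul_sum, Finset.mul_sum, ← Fin.sum_univ_eq_sum_range,
    ← Fin.sum_univ_eq_sum_range, Real.exp_sum, Real.exp_sum, lowKernel]
  have hb' : (2 : ℝ) ≤ P.b := by exact_mod_cast hb
  refine mul_le_mul (Finset.prod_le_prod (fun j _ => (Real.exp_pos _).le) fun j _ => ?_)
    (Finset.prod_le_prod (fun j _ => (Real.exp_pos _).le) fun j _ => ?_)
    (Finset.prod_nonneg fun j _ => (Real.exp_pos _).le) (Finset.prod_nonneg fun j _ => ?_)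
  · have h3 : 0 ≤ c * P.γ₁ j := mul_nonneg hc.pos.le (h₁ j).le
    have h4 := exp_half_le_one_add h3 (hc.walsh j)
    rw [div_mul_eq_mul_div, sub_self, if_pos (dvd_zero _)]
    nlinarith
  · have h3 : 0 ≤ c * P.γ₂ j := mul_nonneg hc.pos.le (h₂ j).le
    have h4 := exp_half_le_one_add h3 (by linarith [hc.korobov j])
    rw [div_mul_eq_mul_div, sub_self, mul_zero, Real.cos_zero]
    linarith
  · have h3 : 0 ≤ c * P.γ₁ j := mul_nonneg hc.pos.le (h₁ j).le
    rw [sub_self, if_pos (dvd_zero _)]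
    nlinarith

lemma lowWeight_pos {c : ℝ} (hc : 0 < c) (h₁ : ∀ j, 0 < P.γ₁ j) (h₂ : ∀ j, 0 < P.γ₂ j)
    (h : Freq s₁ s₂) : 0 < lowWeight P c h := by
  refine mul_pos (Finset.prod_pos fun j _ => ?_) (Finset.prod_pos fun j _ => ?_)
  · have := mul_pos hc (h₁ j)
    split_ifs <;> linarith
  · have := mul_pos hc (h₂ j)
    split_ifs <;> linarith

lemma lowWeight_zero (c : ℝ) : lowWeight P c (0 : Freq s₁ s₂) = 1 := by
  simp [lowWeight]

/-- For 1 ≤ k < b and for |l| = 1 the decay is γ itself, independent of the smoothness, and c ≤ 1.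
-/
lemma lowWeight_le_decay {c : ℝ} (hc : IsReduction P c) (h₁ : ∀ j, 0 < P.γ₁ j)
    (h₂ : ∀ j, 0 < P.γ₂ j) {h : Freq s₁ s₂} (hh : h ∈ lowFreq P.b s₁ s₂) :
    lowWeight P c h ≤ decay P h := by
  simp only [lowFreq, Finset.mem_product, Fintype.mem_piFinset] at hh
  have h3 : ∀ j : Fin s₁, 0 ≤ if h.1 j = 0 then 1 else c * P.γ₁ j := fun j => by
    have := mul_pos hc.pos (h₁ j)
    split_ifs <;> linarith
  have h4 : ∀ j : Fin s₂, 0 ≤ if h.2 j = 0 then 1 else c * P.γ₂ j := fun j => by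
    have := mul_pos hc.pos (h₂ j)
    split_ifs <;> linarith
  have h5 : ∀ j : Fin s₁, (if h.1 j = 0 then 1 else c * P.γ₁ j) ≤
      rWalsh P.b P.α₁ (P.γ₁ j) (h.1 j) := fun j => by
    rw [rWalsh, Nat.log_of_lt (Finset.mem_range.1 (hh.1 j))]
    split_ifs
    · exact le_rfl
    · simp only [Nat.cast_zero, mul_zero, neg_zero, Real.rpow_zero, mul_one]
      exact mul_le_of_le_one_left (h₁ j).le hc.le_one
  have h6 : ∀ j : Fin s₂, (if h.2 j = 0 then 1 else c * P.γ₂ j) ≤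
      rKorobov P.α₂ (P.γ₂ j) (h.2 j) := fun j => by
    have h7 := hh.2 j
    simp only [Finset.mem_insert, Finset.mem_singleton] at h7
    have h8 := mul_le_of_le_one_left (h₂ j).le hc.le_one
    rcases h7 with h7 | h7 | h7 <;> rw [h7] <;> simp [rKorobov, h8]
  exact mul_le_mul (Finset.prod_le_prod (fun j _ => h3 j) fun j _ => h5 j)
    (Finset.prod_le_prod (fun j _ => h4 j) fun j _ => h6 j) (Finset.prod_nonneg fun j _ => h4 j)
    (Finset.prod_nonneg fun j _ => (h3 j).trans (h5 j))

/-- A single function in the unit ball, built from the frequencies in `F`, bounds the worst-case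
error from below. -/
lemma ofReal_sqrt_le_wce (hb : 2 ≤ P.b) (h₁ : ∀ j, 0 < P.γ₁ j)
    (h₂ : ∀ j, 0 < P.γ₂ j) {N : ℕ} (S : Fin N → Cube s₁ s₂) (F : Finset (Freq s₁ s₂))
    (h0F : 0 ∉ F) {ρ : Freq s₁ s₂ → ℝ} (hρ : ∀ h, 0 ≤ ρ h) (hρd : ∀ h ∈ F, ρ h ≤ decay P h) :
    ENNReal.ofReal (Real.sqrt (∑ h ∈ F, ρ h * ‖qmc S (basisFun P.b h)‖ ^ 2)) ≤ wce P S := by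
  set W : Freq s₁ s₂ → ℂ := fun h => qmc S (basisFun P.b h) with hW
  set A2 := ∑ h ∈ F, ρ h * ‖W h‖ ^ 2 with hA2
  have hA2nn : 0 ≤ A2 := Finset.sum_nonneg fun h _ => mul_nonneg (hρ h) (sq_nonneg _)
  set A := Real.sqrt A2 with hA
  rcases (Real.sqrt_nonneg A2).eq_or_lt with h0 | hApos
  · rw [hA, ← h0]
    simp
  have hAsq : A * A = A2 := Real.mul_self_sqrt hA2nn
  have hApos' : 0 < A := hApos
  -- Extremal coefficients in Cauchy–Schwarz for the weights ρ, normalized so that the rule takes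
  -- the value A; ρ ≤ r keeps the function in the unit ball.
  set a : Freq s₁ s₂ → ℂ := fun h => ρ h * (starRingEnd ℂ) (W h) / A with ha
  have hf : (fun p => ∑ h ∈ F, a h * basisFun P.b h p) ∈ unitBall P s₁ s₂ := by
    refine ⟨memHybrid_sum_basisFun hb F a, ?_⟩
    rw [hybridNorm_sum_basisFun hb F a, Real.sqrt_le_left zero_le_one, one_pow]
    calc ∑ h ∈ F, (decay P h)⁻¹ * ‖a h‖ ^ 2 ≤ ∑ h ∈ F, ρ h * ‖W h‖ ^ 2 / A ^ 2 := by
          refine Finset.sum_le_sum fun h hh => ?_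
          have hd := decay_pos hb h₁ h₂ h
          have h3 : ‖a h‖ = ρ h * ‖W h‖ / A := by
            simp only [ha, norm_div, norm_mul, Complex.norm_real, RCLike.norm_conj,
              Real.norm_of_nonneg (hρ h), Real.norm_of_nonneg hApos'.le]
          have h4 : (decay P h)⁻¹ * ρ h ≤ 1 := by
            rw [inv_mul_le_iff₀ hd, mul_one]
            exact hρd h hh
          calc (decay P h)⁻¹ * ‖a h‖ ^ 2
              = ((decay P h)⁻¹ * ρ h) * (ρ h * ‖W h‖ ^ 2 / A ^ 2) := by
                rw [h3]
                ring
            _ ≤ 1 * (ρ h * ‖W h‖ ^ 2 / A ^ 2) := by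
                refine mul_le_mul_of_nonneg_right h4 ?_
                have := hρ h
                positivity
            _ = _ := one_mul _
      _ = 1 := by
          rw [← Finset.sum_div, ← hA2, ← hAsq, pow_two]
          exact div_self (by positivity)
  have hint : ∫ p, (fun p => ∑ h ∈ F, a h * basisFun P.b h p) p = 0 := by
    rw [← coeff_zero P.b, coeff_sum_basisFun hb, if_neg h0F]
  have hq : qmc S (fun p => ∑ h ∈ F, a h * basisFun P.b h p) = A := by
    have h3 : qmc S (fun p => ∑ h ∈ F, a h * basisFun P.b h p) = ∑ h ∈ F, a h * W h := by
      simp only [hW, qmc]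
      rw [Finset.sum_comm, Finset.mul_sum]
      refine Finset.sum_congr rfl fun h _ => ?_
      rw [← Finset.mul_sum]
      ring
    have hAc : (A : ℂ) ≠ 0 := by exact_mod_cast hApos'.ne'
    have h4 : ∀ h, a h * W h = ((ρ h * ‖W h‖ ^ 2 : ℝ) : ℂ) / A := by
      intro h
      push_cast
      rw [← Complex.conj_mul']
      simp only [ha]
      ring
    simp only [h3, h4]
    rw [← Finset.sum_div, ← Complex.ofReal_sum, ← hA2, ← hAsq, Complex.ofReal_mul,
      mul_div_cancel_right₀ _ hAc]
  refine le_iSup₂_of_le _ hf ?_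
  rw [hint, hq, zero_sub, enorm_neg, ← ofReal_norm, Complex.norm_real,
    Real.norm_of_nonneg hApos'.le]

/-- The mean of the kernel over all pairs of points is at least the contribution of the diagonal. -/
lemma exp_div_le_sum_lowWeight (hb : 2 ≤ P.b) {c : ℝ} (hc : IsReduction P c)
    (h₁ : ∀ j, 0 < P.γ₁ j) (h₂ : ∀ j, 0 < P.γ₂ j) {N : ℕ} (hN : 1 ≤ N) (S : Fin N → Cube s₁ s₂) :
    Real.exp (c / 2 * ((∑ j ∈ Finset.range s₁, P.γ₁ j) + ∑ j ∈ Finset.range s₂, P.γ₂ j)) / N ≤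
      ∑ h ∈ lowFreq P.b s₁ s₂, lowWeight P c h * ‖qmc S (basisFun P.b h)‖ ^ 2 := by
  have hN' : (0 : ℝ) < N := by exact_mod_cast hN
  have h3 : ∑ h ∈ lowFreq P.b s₁ s₂, lowWeight P c h * ‖qmc S (basisFun P.b h)‖ ^ 2 =
      1 / (N : ℝ) ^ 2 * ∑ n, ∑ m, lowKernel P c (S n) (S m) := by
    apply Complex.ofReal_injective
    push_cast
    simp only [← sum_lowFreq hb c]
    rw [Finset.sum_congr rfl fun n _ => Finset.sum_comm, Finset.sum_comm, Finset.mul_sum]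
    refine Finset.sum_congr rfl fun h _ => ?_
    simp only [← Finset.mul_sum]
    rw [← Complex.mul_conj', qmc, ← Finset.sum_mul, ← map_sum]
    simp only [map_mul, map_div₀, map_one, Complex.conj_natCast]
    ring
  rw [h3]
  set E := Real.exp (c / 2 * ((∑ j ∈ Finset.range s₁, P.γ₁ j) + ∑ j ∈ Finset.range s₂, P.γ₂ j))
  -- Nonnegativity of the kernel allows all off-diagonal pairs to be dropped.
  have h4 : (N : ℝ) * E ≤ ∑ n, ∑ m, lowKernel P c (S n) (S m) := by
    calc (N : ℝ) * E = ∑ _n : Fin N, E := by simp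
      _ ≤ _ := Finset.sum_le_sum fun n _ => (exp_le_lowKernel_self hb hc h₁ h₂ (S n)).trans
        (Finset.single_le_sum (f := fun m => lowKernel P c (S n) (S m))
          (fun m _ => lowKernel_nonneg hc h₁ h₂ _ _) (Finset.mem_univ n))
  calc E / N = 1 / (N : ℝ) ^ 2 * (N * E) := by field_simp
    _ ≤ _ := by gcongr

lemma zero_mem_lowFreq {b : ℕ} (hb : 2 ≤ b) : (0 : Freq s₁ s₂) ∈ lowFreq b s₁ s₂ := by
  simp only [lowFreq, Finset.mem_product, Fintype.mem_piFinset]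
  refine ⟨fun j => Finset.mem_range.2 ?_, fun j => ?_⟩
  · show 0 < b
    omega
  · simp

/-- Any QMC rule whose minimal error does not exceed the initial error needs a number of points
exponential in the sums of the weights. -/
theorem exp_half_le_of_minError_le_one (hb : 2 ≤ P.b) {c : ℝ} (hc : IsReduction P c)
    (h₁ : ∀ j, 0 < P.γ₁ j) (h₂ : ∀ j, 0 < P.γ₂ j) {N : ℕ} (hN : 1 ≤ N)
    (hE : minError P s₁ s₂ N ≤ 1) :
    Real.exp (c / 2 * ((∑ j ∈ Finset.range s₁, P.γ₁ j) + ∑ j ∈ Finset.range s₂, P.γ₂ j)) / 2 ≤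
      N := by
  set E := Real.exp (c / 2 * ((∑ j ∈ Finset.range s₁, P.γ₁ j) + ∑ j ∈ Finset.range s₂, P.γ₂ j))
  have hN' : (0 : ℝ) < N := by exact_mod_cast hN
  have h3 : ENNReal.ofReal (Real.sqrt (E / N - 1)) ≤ minError P s₁ s₂ N := by
    refine le_iInf fun S => ?_
    refine le_trans (ENNReal.ofReal_le_ofReal (Real.sqrt_le_sqrt ?_))
      (ofReal_sqrt_le_wce hb h₁ h₂ S ((lowFreq P.b s₁ s₂).erase 0) (Finset.notMem_erase _ _)
        (ρ := lowWeight P c) (fun h => (lowWeight_pos hc.pos h₁ h₂ h).le)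
        fun h hh => lowWeight_le_decay hc h₁ h₂ (Finset.mem_of_mem_erase hh))
    have h4 := exp_div_le_sum_lowWeight hb hc h₁ h₂ hN S
    -- Frequency zero contributes exactly 1, since every QMC rule is exact on constants.
    rw [← Finset.add_sum_erase _ _ (zero_mem_lowFreq hb), lowWeight_zero,
      qmc_basisFun_zero hN] at h4
    simp only [norm_one, one_pow, mul_one] at h4
    linarith
  have h5 := h3.trans hE
  rw [ENNReal.ofReal_le_one, Real.sqrt_le_left zero_le_one, one_pow, sub_le_iff_le_add, div_le_iff₀ hN'] at h5
  linarith

/-- Monotonicity bounds all weights by the first ones, so one c serves every coordinate and every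
dimension. -/
lemma exists_isReduction (h₁ : ∀ j, 0 < P.γ₁ j) (h₂ : ∀ j, 0 < P.γ₂ j) (hm₁ : Antitone P.γ₁)
    (hm₂ : Antitone P.γ₂) : ∃ c, IsReduction P c := by
  have a1 := h₁ 0
  have a2 := h₂ 0
  have hD : 0 < 1 + 2 * (P.γ₁ 0 + P.γ₂ 0) := by positivity
  refine ⟨(1 + 2 * (P.γ₁ 0 + P.γ₂ 0))⁻¹, inv_pos.2 hD, inv_le_one_of_one_le₀ (by linarith),
    fun j => ?_, fun j => ?_⟩
  · rw [inv_mul_le_iff₀ hD]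
    linarith [hm₁ (Nat.zero_le j)]
  · rw [mul_left_comm, inv_mul_le_iff₀ hD]
    linarith [hm₂ (Nat.zero_le j)]

end

/-! ### From the two bounds to the growth criteria -/

section

lemma eventually_totalDimAtTop {p : ℕ × ℕ → Prop} :
    (∀ᶠ s in totalDimAtTop, p s) ↔ ∃ n, ∀ s : ℕ × ℕ, n ≤ s.1 + s.2 → p s := by
  rw [totalDimAtTop, eventually_comap, eventually_atTop]
  constructor
  · rintro ⟨n, hn⟩
    exact ⟨n, fun s hs => hn _ hs s rfl⟩
  · rintro ⟨n, hn⟩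
    exact ⟨n, fun m hm s hs => hn s (hs ▸ hm)⟩

/-- Exponential lower bound for the information complexity, at `ε = 1`. -/
theorem exists_exp_le_infoComplexity {P : Params} (hb : 2 ≤ P.b) (hα₁ : 1 < P.α₁)
    (hα₂ : 1 < P.α₂) (h₁ : ∀ j, 0 < P.γ₁ j) (h₂ : ∀ j, 0 < P.γ₂ j) (hm₁ : Antitone P.γ₁)
    (hm₂ : Antitone P.γ₂) :
    ∃ c : ℝ, 0 < c ∧ ∀ s₁ s₂ : ℕ,
      Real.exp (c * ((∑ j ∈ Finset.range s₁, P.γ₁ j) + ∑ j ∈ Finset.range s₂, P.γ₂ j)) / 2 ≤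
        infoComplexity P 1 s₁ s₂ := by
  obtain ⟨c, hc⟩ := exists_isReduction h₁ h₂ hm₁ hm₂
  obtain ⟨μ, -, hμ⟩ := exists_infoComplexity_le hb hα₁ hα₂ h₁ h₂
  refine ⟨c / 2, half_pos hc.pos, fun s₁ s₂ => ?_⟩
  have h := (hμ s₁ s₂ 1 one_pos le_rfl).1
  exact exp_half_le_of_minError_le_one hb hc h₁ h₂ h.1 (by simpa using h.2)

section Growth

variable {P : Params} {A B : ℕ → ℝ} {μ c : ℝ}

lemma mul_le_log_of_exp_half_le {x y : ℝ} (h : Real.exp x / 2 ≤ y) :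
    x ≤ Real.log 2 + Real.log y := by
  have hy : 0 < y := lt_of_lt_of_le (by positivity) h
  rw [← Real.log_mul two_ne_zero hy.ne', Real.le_log_iff_exp_le (by positivity)]
  linarith

lemma stronglyPolynomiallyTractable_iff (hA : Monotone A) (hμ : 0 ≤ μ) (hc : 0 < c)
    (hU : ∀ (s₁ s₂ : ℕ) (ε : ℝ), 0 < ε → ε ≤ 1 → (infoComplexity P ε s₁ s₂ : ℝ) ≤
      2 * ε ^ (-2 : ℝ) * Real.exp (μ * (A s₁ + B s₂)))
    (hL : ∀ s₁ s₂ : ℕ, Real.exp (c * (A s₁ + B s₂)) / 2 ≤ infoComplexity P 1 s₁ s₂) :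
    StronglyPolynomiallyTractable P ↔
      ∃ C : ℝ, ∀ᶠ s : ℕ × ℕ in totalDimAtTop, A s.1 + B s.2 ≤ C := by
  simp only [eventually_totalDimAtTop]
  constructor
  · rintro ⟨C, p, -, -, h⟩
    refine ⟨(Real.log 2 + Real.log C) / c, 1, fun s hs => ?_⟩
    rw [le_div_iff₀' hc]
    refine mul_le_log_of_exp_half_le ((hL s.1 s.2).trans ?_)
    simpa using h s.1 s.2 hs 1 one_pos le_rfl
  · rintro ⟨C, n, h⟩
    refine ⟨2 * Real.exp (μ * C), 2, by positivity, by norm_num, fun s₁ s₂ _ ε hε hε1 => ?_⟩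
    refine (hU s₁ s₂ ε hε hε1).trans ?_
    have h3 : A s₁ + B s₂ ≤ C := by
      -- Enlarging s₁ reaches the range of the eventual bound; monotonicity brings it back to (s₁,
      -- s₂).
      have h4 := h (s₁ + n, s₂) (by dsimp only; omega)
      have h5 := hA (Nat.le_add_right s₁ n)
      dsimp only at h4
      linarith
    rw [mul_right_comm]
    gcongr

lemma polynomiallyTractable_iff (hA : Monotone A) (hB : Monotone B) (hA0 : A 0 = 0) (hB0 : B 0 = 0)
    (hμ : 0 ≤ μ) (hc : 0 < c)
    (hU : ∀ (s₁ s₂ : ℕ) (ε : ℝ), 0 < ε → ε ≤ 1 → (infoComplexity P ε s₁ s₂ : ℝ) ≤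
      2 * ε ^ (-2 : ℝ) * Real.exp (μ * (A s₁ + B s₂)))
    (hL : ∀ s₁ s₂ : ℕ, Real.exp (c * (A s₁ + B s₂)) / 2 ≤ infoComplexity P 1 s₁ s₂) :
    PolynomiallyTractable P ↔
      ∃ C : ℝ, ∀ᶠ s : ℕ × ℕ in totalDimAtTop, 2 ≤ s.1 → 2 ≤ s.2 →
        A s.1 / Real.log s.1 + B s.2 / Real.log s.2 ≤ C := by
  have hAn : ∀ s, 0 ≤ A s := fun s => hA0 ▸ hA (Nat.zero_le s)
  have hBn : ∀ s, 0 ≤ B s := fun s => hB0 ▸ hB (Nat.zero_le s)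
  simp only [eventually_totalDimAtTop]
  constructor
  · rintro ⟨C, p, q, -, -, hq, h⟩
    -- Applied to one weight sequence at a time, the other dimension being zero. The constant log 2
    -- + log C is absorbed into log s because s ≥ 2.
    have key : ∀ (s : ℕ) (x : ℝ), 2 ≤ s → Real.exp (c * x) / 2 ≤ C * (s : ℝ) ^ q →
        x / Real.log s ≤ (|Real.log 2 + Real.log C| / Real.log 2 + q) / c := by
      intro s x hs hx
      have hs' : (2 : ℝ) ≤ s := by exact_mod_cast hs
      have hs0 : (0 : ℝ) < s := by linarith
      have hl2 : 0 < Real.log 2 := Real.log_pos one_lt_two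
      have hls : Real.log 2 ≤ Real.log s := Real.log_le_log two_pos hs'
      have hsq : (s : ℝ) ^ q ≠ 0 := (Real.rpow_pos_of_pos hs0 q).ne'
      have hC : C ≠ 0 := by
        rintro rfl
        have := Real.exp_pos (c * x)
        linarith
      have h3 := mul_le_log_of_exp_half_le hx
      rw [Real.log_mul hC hsq, Real.log_rpow hs0] at h3
      rw [div_le_div_iff₀ (by linarith) hc]
      have h4 := le_abs_self (Real.log 2 + Real.log C)
      have h5 : |Real.log 2 + Real.log C| ≤
          |Real.log 2 + Real.log C| / Real.log 2 * Real.log s := by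
        rw [div_mul_eq_mul_div, le_div_iff₀ hl2]
        exact mul_le_mul_of_nonneg_left hls (abs_nonneg _)
      linarith
    refine ⟨(|Real.log 2 + Real.log C| / Real.log 2 + q) / c +
      (|Real.log 2 + Real.log C| / Real.log 2 + q) / c, 0, fun s _ hs₁ hs₂ => ?_⟩
    refine add_le_add (key _ _ hs₁ ?_) (key _ _ hs₂ ?_)
    · have h3 := (hL s.1 0).trans (h s.1 0 (by omega) 1 one_pos le_rfl)
      simpa [hB0] using h3
    · have h3 := (hL 0 s.2).trans (h 0 s.2 (by omega) 1 one_pos le_rfl)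
      simpa [hA0] using h3
  · rintro ⟨C, n, h⟩
    have hlog : ∀ s : ℕ, 0 ≤ Real.log s := fun s => Real.log_natCast_nonneg s
    have hlog' : ∀ s : ℕ, 2 ≤ s → 0 < Real.log s := fun s hs =>
      Real.log_pos (by exact_mod_cast hs)
    have hCA : ∀ s : ℕ, 2 ≤ s → A s ≤ C * Real.log s := by
      intro s hs
      -- The second dimension n + 2 meets both side conditions, and its nonnegative term is then
      -- dropped.
      have h3 := h (s, n + 2) (by dsimp only; omega) hs (by dsimp only; omega)
      have h4 := div_nonneg (hBn (n + 2)) (hlog (n + 2))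
      rw [← div_le_iff₀ (hlog' s hs)]
      dsimp only at h3
      linarith
    have hCB : ∀ s : ℕ, 2 ≤ s → B s ≤ C * Real.log s := by
      intro s hs
      have h3 := h (n + 2, s) (by dsimp only; omega) (by dsimp only; omega) hs
      have h4 := div_nonneg (hAn (n + 2)) (hlog (n + 2))
      rw [← div_le_iff₀ (hlog' s hs)]
      dsimp only at h3
      linarith
    have hC : 0 ≤ C := by
      have h3 := (hAn 2).trans (hCA 2 le_rfl)
      exact nonneg_of_mul_nonneg_left h3 (hlog' 2 le_rfl)
    refine ⟨2 * (2 : ℝ) ^ (2 * μ * C), 2, 2 * μ * C, by positivity, by norm_num, by positivity,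
      fun s₁ s₂ hs ε hε hε1 => ?_⟩
    set s := s₁ + s₂
    have hs' : (1 : ℝ) ≤ (s : ℝ) := by exact_mod_cast hs
    have h2s : (0 : ℝ) < 2 * (s : ℝ) := by linarith
    have h3 : A s₁ + B s₂ ≤ 2 * C * Real.log (2 * s) := by
      -- Passing to s + 1 ≥ 2 covers s₁ or s₂ below 2, where the logarithmic bound is not available;
      -- then s + 1 ≤ 2s.
      have h4 := (hA (by omega : s₁ ≤ s + 1)).trans (hCA (s + 1) (by omega))
      have h5 := (hB (by omega : s₂ ≤ s + 1)).trans (hCB (s + 1) (by omega))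
      have h6 : Real.log ((s + 1 : ℕ) : ℝ) ≤ Real.log (2 * s) := by
        apply Real.log_le_log
        · positivity
        · push_cast
          linarith
      have h7 := mul_le_mul_of_nonneg_left h6 hC
      linarith
    calc (infoComplexity P ε s₁ s₂ : ℝ)
        ≤ 2 * ε ^ (-2 : ℝ) * Real.exp (μ * (A s₁ + B s₂)) := hU s₁ s₂ ε hε hε1
      _ ≤ 2 * ε ^ (-2 : ℝ) * Real.exp (μ * (2 * C * Real.log (2 * s))) := by gcongr
      _ = 2 * ε ^ (-2 : ℝ) * (2 * (s : ℝ)) ^ (2 * μ * C) := by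
          rw [Real.rpow_def_of_pos h2s]
          congr 2
          ring
      _ = _ := by
          rw [Real.mul_rpow two_pos.le (by linarith)]
          ring

/-- Taking logarithms gives c x ≤ log 2 + log n. The denominator s + 1 is s + ε⁻¹ at ε = 1, and it
is at most 2s. -/
lemma tendsto_div_of_log_bound {x : ℕ → ℝ} {n : ℕ → ℕ} (hx : ∀ s, 0 ≤ x s) (hc : 0 < c)
    (hL : ∀ s, Real.exp (c * x s) / 2 ≤ n s)
    (hn : Tendsto (fun s : ℕ => Real.log (n s) / ((s : ℝ) + 1)) atTop (𝓝 0)) :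
    Tendsto (fun s : ℕ => x s / s) atTop (𝓝 0) := by
  have h1 : Tendsto (fun s : ℕ => (Real.log 2 / (s : ℝ) + 2 * (Real.log (n s) / ((s : ℝ) + 1))) / c)
      atTop (𝓝 0) := by
    simpa using ((tendsto_const_div_atTop_nhds_zero_nat (Real.log 2)).add
      (hn.const_mul 2)).div_const c
  refine tendsto_of_tendsto_of_tendsto_of_le_of_le' tendsto_const_nhds h1
    (Eventually.of_forall fun s => div_nonneg (hx s) (Nat.cast_nonneg s)) ?_
  filter_upwards [eventually_ge_atTop 1] with s hs
  have hs' : (1 : ℝ) ≤ s := by exact_mod_cast hs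
  have hs0 : (0 : ℝ) < s := by linarith
  have h3 := mul_le_log_of_exp_half_le (hL s)
  have h4 : 0 ≤ Real.log (n s) := Real.log_natCast_nonneg _
  have h5 : Real.log (n s) / s ≤ 2 * (Real.log (n s) / ((s : ℝ) + 1)) := by
    rw [← mul_div_assoc, div_le_div_iff₀ hs0 (by linarith)]
    nlinarith
  rw [le_div_iff₀ hc, div_mul_eq_mul_div]
  calc x s * c / s ≤ (Real.log 2 + Real.log (n s)) / s := by
        gcongr
        linarith
    _ = Real.log 2 / s + Real.log (n s) / s := add_div _ _ _
    _ ≤ _ := by linarith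

/-- Large s obey the ratio bound; the remaining ones are covered by a constant through monotonicity.
This makes the later estimate uniform in both dimensions. -/
lemma exists_le_mul_add (hA : Monotone A) (hA0 : 0 ≤ A 0)
    (h : ∀ δ : ℝ, 0 < δ → ∃ a : ℕ, ∀ s ≥ a, A s / s ≤ δ) {δ : ℝ} (hδ : 0 < δ) :
    ∃ M : ℝ, ∀ s : ℕ, A s ≤ δ * s + M := by
  obtain ⟨a, ha⟩ := h δ hδ
  refine ⟨A (a + 1), fun s => ?_⟩
  have hnn : 0 ≤ A (a + 1) := hA0.trans (hA (Nat.zero_le _))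
  rcases le_total s (a + 1) with hs | hs
  · have h3 := hA hs
    have h4 : 0 ≤ δ * (s : ℝ) := by positivity
    linarith
  · have h3 := ha s (by omega)
    have hs0 : (0 : ℝ) < s := by exact_mod_cast (by omega : 0 < s)
    rw [div_le_iff₀ hs0] at h3
    linarith

lemma weaklyTractable_iff (hA : Monotone A) (hB : Monotone B) (hA0 : A 0 = 0) (hB0 : B 0 = 0)
    (hμ : 0 ≤ μ) (hc : 0 < c)
    (hpos : ∀ (s₁ s₂ : ℕ) (ε : ℝ), 0 < ε → ε ≤ 1 → 1 ≤ infoComplexity P ε s₁ s₂)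
    (hU : ∀ (s₁ s₂ : ℕ) (ε : ℝ), 0 < ε → ε ≤ 1 → (infoComplexity P ε s₁ s₂ : ℝ) ≤
      2 * ε ^ (-2 : ℝ) * Real.exp (μ * (A s₁ + B s₂)))
    (hL : ∀ s₁ s₂ : ℕ, Real.exp (c * (A s₁ + B s₂)) / 2 ≤ infoComplexity P 1 s₁ s₂) :
    WeaklyTractable P ↔
      Tendsto (fun s : ℕ × ℕ => A s.1 / (s.1 : ℝ) + B s.2 / (s.2 : ℝ)) (atTop ×ˢ atTop) (𝓝 0) := by
  have hAn : ∀ s, 0 ≤ A s := fun s => hA0 ▸ hA (Nat.zero_le s)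
  have hBn : ∀ s, 0 ≤ B s := fun s => hB0 ▸ hB (Nat.zero_le s)
  constructor
  · intro h
    have hlim : Tendsto (fun s : ℕ => (s : ℝ) + 1) atTop atTop :=
      tendsto_atTop_add_const_right _ _ tendsto_natCast_atTop_atTop
    have t₁ : Tendsto (fun s : ℕ => A s / s) atTop (𝓝 0) := by
      refine tendsto_div_of_log_bound hAn hc (n := fun s => infoComplexity P 1 s 0)
        (fun s => by simpa [hB0] using hL s 0) ?_
      have h3 : Tendsto (fun s : ℕ => ((s, 0, 1) : ℕ × ℕ × ℝ)) atTop
          (comap (fun t : ℕ × ℕ × ℝ => (t.1 : ℝ) + t.2.1 + t.2.2⁻¹) atTop ⊓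
            𝓟 {t | 1 ≤ t.1 + t.2.1 ∧ 0 < t.2.2 ∧ t.2.2 ≤ 1}) := by
        refine tendsto_inf.2 ⟨tendsto_comap_iff.2 ?_, tendsto_principal.2 ?_⟩
        · simpa [Function.comp_def] using hlim
        · filter_upwards [eventually_ge_atTop 1] with s hs
          simpa using hs
      simpa [Function.comp_def] using h.comp h3
    have t₂ : Tendsto (fun s : ℕ => B s / s) atTop (𝓝 0) := by
      refine tendsto_div_of_log_bound hBn hc (n := fun s => infoComplexity P 1 0 s)
        (fun s => by simpa [hA0] using hL 0 s) ?_
      have h3 : Tendsto (fun s : ℕ => ((0, s, 1) : ℕ × ℕ × ℝ)) atTop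
          (comap (fun t : ℕ × ℕ × ℝ => (t.1 : ℝ) + t.2.1 + t.2.2⁻¹) atTop ⊓
            𝓟 {t | 1 ≤ t.1 + t.2.1 ∧ 0 < t.2.2 ∧ t.2.2 ≤ 1}) := by
        refine tendsto_inf.2 ⟨tendsto_comap_iff.2 ?_, tendsto_principal.2 ?_⟩
        · simpa [Function.comp_def] using hlim
        · filter_upwards [eventually_ge_atTop 1] with s hs
          simpa using hs
      simpa [Function.comp_def] using h.comp h3
    simpa using (t₁.comp tendsto_fst).add (t₂.comp tendsto_snd)
  · intro h
    have hboth : ∀ δ : ℝ, 0 < δ → ∃ a : ℕ × ℕ, ∀ s ≥ a,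
        A s.1 / (s.1 : ℝ) + B s.2 / (s.2 : ℝ) < δ := by
      intro δ hδ
      rw [prod_atTop_atTop_eq] at h
      exact eventually_atTop.1 (h.eventually_lt_const hδ)
    have hdA : ∀ s : ℕ, 0 ≤ A s / s := fun s => div_nonneg (hAn s) (Nat.cast_nonneg s)
    have hdB : ∀ s : ℕ, 0 ≤ B s / s := fun s => div_nonneg (hBn s) (Nat.cast_nonneg s)
    have hA' : ∀ δ : ℝ, 0 < δ → ∃ a : ℕ, ∀ s ≥ a, A s / s ≤ δ := fun δ hδ => by
      obtain ⟨a, ha⟩ := hboth δ hδ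
      -- The other index is frozen at its threshold and its nonnegative term dropped.
      refine ⟨a.1, fun s hs => ?_⟩
      have h3 := ha (s, a.2) ⟨hs, le_rfl⟩
      have h4 := hdB a.2
      dsimp only at h3
      linarith
    have hB' : ∀ δ : ℝ, 0 < δ → ∃ a : ℕ, ∀ s ≥ a, B s / s ≤ δ := fun δ hδ => by
      obtain ⟨a, ha⟩ := hboth δ hδ
      refine ⟨a.2, fun s hs => ?_⟩
      have h3 := ha (a.1, s) ⟨le_rfl, hs⟩
      have h4 := hdA a.1
      dsimp only at h3
      linarith
    unfold WeaklyTractable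
    rw [Metric.tendsto_nhds]
    intro η hη
    -- With this δ the linear part of the exponent uses at most half of η; the constants and log T
    -- share the other half.
    set δ : ℝ := η / (2 * (μ + 1)) with hδ
    have hδ0 : 0 < δ := by positivity
    have hμδ : μ * δ ≤ η / 2 := by
      rw [hδ, ← mul_div_assoc, div_le_div_iff₀ (by positivity) two_pos]
      nlinarith
    obtain ⟨M₁, hM₁⟩ := exists_le_mul_add hA hA0.ge hA' hδ0
    obtain ⟨M₂, hM₂⟩ := exists_le_mul_add hB hB0.ge hB' hδ0
    have hlim : Tendsto (fun T : ℝ => (Real.log 2 + μ * (M₁ + M₂)) / T + 2 * (Real.log T / T))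
        atTop (𝓝 0) := by
      have h3 : Tendsto (fun T : ℝ => Real.log T / T) atTop (𝓝 0) :=
        Real.isLittleO_log_id_atTop.tendsto_div_nhds_zero
      simpa using (tendsto_const_nhds.div_atTop tendsto_id).add (h3.const_mul 2)
    have hev := hlim.eventually_lt_const (half_pos hη)
    filter_upwards [mem_inf_of_right (mem_principal_self _),
      mem_inf_of_left (preimage_mem_comap hev)] with t ht htT
    obtain ⟨s₁, s₂, ε⟩ := t
    obtain ⟨-, hε, hε1⟩ := ht
    dsimp only at hε hε1
    simp only [Set.mem_preimage, Set.mem_ofPred_eq] at htT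
    set T : ℝ := (s₁ : ℝ) + s₂ + ε⁻¹ with hT
    have hεi : 0 < ε⁻¹ := inv_pos.2 hε
    have hs : (0 : ℝ) ≤ (s₁ : ℝ) + s₂ := by positivity
    have hT0 : 0 < T := by linarith
    have hn : (1 : ℝ) ≤ infoComplexity P ε s₁ s₂ := by exact_mod_cast hpos s₁ s₂ ε hε hε1
    have hlogn : Real.log (infoComplexity P ε s₁ s₂) ≤
        Real.log 2 + 2 * Real.log T + μ * (A s₁ + B s₂) := by
      refine (Real.log_le_log (by linarith) (hU s₁ s₂ ε hε hε1)).trans ?_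
      have h3 : ε ^ (-2 : ℝ) ≠ 0 := (Real.rpow_pos_of_pos hε _).ne'
      rw [Real.log_mul (mul_ne_zero two_ne_zero h3) (Real.exp_pos _).ne',
        Real.log_mul two_ne_zero h3, Real.log_exp, Real.log_rpow hε]
      -- Since ε⁻¹ ≤ T, the factor ε⁻² costs only 2 log T = o(T).
      have h4 : Real.log ε⁻¹ ≤ Real.log T := Real.log_le_log hεi (by linarith)
      rw [Real.log_inv] at h4
      linarith
    have h5 : μ * (A s₁ + B s₂) ≤ η / 2 * T + μ * (M₁ + M₂) := by
      have h6 : μ * (A s₁ + B s₂) ≤ μ * (δ * (s₁ + s₂) + (M₁ + M₂)) := by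
        refine mul_le_mul_of_nonneg_left ?_ hμ
        linarith [hM₁ s₁, hM₂ s₂]
      have h7 : μ * δ * (s₁ + s₂) ≤ η / 2 * T :=
        mul_le_mul hμδ (by linarith) hs (by positivity)
      linarith
    rw [Real.dist_eq, sub_zero, abs_of_nonneg (div_nonneg (Real.log_nonneg hn) hT0.le),
      div_lt_iff₀ hT0]
    rw [← mul_div_assoc, ← add_div, div_lt_iff₀ hT0] at htT
    linarith

end Growth

end

end HybridQMC

theorem theorem1 (b : ℕ) (hb : 2 ≤ b) (α₁ α₂ : ℝ) (hα₁ : 1 < α₁) (hα₂ : 1 < α₂)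
    (γ₁ γ₂ : ℕ → ℝ) (hγ₁ : ∀ j, 0 < γ₁ j) (hγ₂ : ∀ j, 0 < γ₂ j)
    (hmono₁ : Antitone γ₁) (hmono₂ : Antitone γ₂) :
    (HybridQMC.StronglyPolynomiallyTractable ⟨b, α₁, α₂, γ₁, γ₂⟩ ↔
      ∃ C : ℝ, ∀ᶠ s : ℕ × ℕ in HybridQMC.totalDimAtTop,
        (∑ j ∈ Finset.range s.1, γ₁ j) + (∑ j ∈ Finset.range s.2, γ₂ j) ≤ C) ∧
    (HybridQMC.PolynomiallyTractable ⟨b, α₁, α₂, γ₁, γ₂⟩ ↔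
      ∃ C : ℝ, ∀ᶠ s : ℕ × ℕ in HybridQMC.totalDimAtTop, 2 ≤ s.1 → 2 ≤ s.2 →
        (∑ j ∈ Finset.range s.1, γ₁ j) / Real.log s.1 +
          (∑ j ∈ Finset.range s.2, γ₂ j) / Real.log s.2 ≤ C) ∧
    (HybridQMC.WeaklyTractable ⟨b, α₁, α₂, γ₁, γ₂⟩ ↔
      Tendsto
        (fun s : ℕ × ℕ => (∑ j ∈ Finset.range s.1, γ₁ j) / (s.1 : ℝ) +
          (∑ j ∈ Finset.range s.2, γ₂ j) / (s.2 : ℝ))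
        (atTop ×ˢ atTop) (𝓝 0)) := by
  set P : HybridQMC.Params := ⟨b, α₁, α₂, γ₁, γ₂⟩ with hP
  have hA : Monotone fun s => ∑ j ∈ Finset.range s, γ₁ j := fun s t hst =>
    Finset.sum_le_sum_of_subset_of_nonneg (Finset.range_mono hst) fun j _ _ => (hγ₁ j).le
  have hB : Monotone fun s => ∑ j ∈ Finset.range s, γ₂ j := fun s t hst =>
    Finset.sum_le_sum_of_subset_of_nonneg (Finset.range_mono hst) fun j _ _ => (hγ₂ j).le
  obtain ⟨μ, hμ, hU⟩ := HybridQMC.exists_infoComplexity_le (P := P) hb hα₁ hα₂ hγ₁ hγ₂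
  obtain ⟨c, hc, hL⟩ :=
    HybridQMC.exists_exp_le_infoComplexity (P := P) hb hα₁ hα₂ hγ₁ hγ₂ hmono₁ hmono₂
  have hU' := fun s₁ s₂ ε hε hε1 => (hU s₁ s₂ ε hε hε1).2
  exact ⟨HybridQMC.stronglyPolynomiallyTractable_iff hA hμ hc hU' hL,
    HybridQMC.polynomiallyTractable_iff hA hB rfl rfl hμ hc hU' hL,
    HybridQMC.weaklyTractable_iff hA hB rfl rfl hμ hc
      (fun s₁ s₂ ε hε hε1 => (hU s₁ s₂ ε hε hε1).1.1) hU' hL⟩
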